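/- Let $m \ge 4$ be an even integer, let $k, \ell$ be integers coprime to $m$ with $0 < k, \ell < \frac{m}{2}$, let $s, t$ be even integers with $0 \le s, t \le \frac{m}{2}$, and let $\alpha, \beta \in \mathbb{F}_{2^m}^*$ be non-cubes. Call two functions $f, g \colon V \to V$ on a finite-dimensional vector space $V$ over $\mathbb{F}_2$ CCZ-equivalent if there is an affine permutation $C$ of the $\mathbb{F}_2$-vector space $V \times V$ with $C(\{(x, f(x)) : x \in V\}) = \{(x, g(x)) : x \in V\}$. Then the two Pott–Zhou APN functions $f_{k,s,\alpha}, f_{\ell,t,\beta} \colon \mathbb{F}_{2^m}^2 \to \mathbb{F}_{2^m}^2$ given by $$f_{k,s,\alpha}(x,y) = \left(x^{2^k+1} + \alpha y^{(2^k+1)2^s},\ xy\right) \quad\text{and}\quad f_{\ell,t,\beta}(x,y) = \left(x^{2^\ell+1} + \beta y^{(2^\ell+1)2^t},\ xy\right)$$ are CCZ-equivalent if and only if $k = \ell$ and $s = t$. -/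

import Mathlib

/-- Two functions `f, g : V → W` between vector spaces over `𝔽₂` are CCZ-equivalent
(Carlet-Charpin-Zinoviev equivalent) if some affine permutation `C` of `V × W` over `𝔽₂` maps the
graph `{(x, f x) : x ∈ V}` of `f` onto the graph of `g`. -/
def CCZEquivalent {V W : Type*} [AddCommGroup V] [Module (ZMod 2) V]
    [AddCommGroup W] [Module (ZMod 2) W] (f g : V → W) : Prop :=
  ∃ C : (V × W) ≃ᵃ[ZMod 2] (V × W),
    C '' (Set.range fun x : V => (x, f x)) = Set.range fun x : V => (x, g x)

/-- The Pott-Zhou function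
`f_{k,s,α} (x, y) = (x ^ (2 ^ k + 1) + α * y ^ ((2 ^ k + 1) * 2 ^ s), x * y)` on `F × F`. -/
def pottZhou {F : Type*} [Field F] (k s : ℕ) (α : F) (p : F × F) : F × F :=
  (p.1 ^ (2 ^ k + 1) + α * p.2 ^ ((2 ^ k + 1) * 2 ^ s), p.1 * p.2)

/-!
Write `f = f_{k,s,α}`, `g = f_{ℓ,t,β}`, and let `B_{k,s,α}`, `B_{ℓ,t,β}` be their polar forms.

If `k = ℓ` and `s = t`, then `β = a ^ (2 ^ k + 1) * α ^ 2 ^ e` for some `a ≠ 0` and `e`, because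
`(2 ^ k + 1)`-th powers are the same as cubes and squaring interchanges the two classes of
non-cubes; the substitution `(x, y) ↦ (a * x ^ 2 ^ e, y ^ 2 ^ e)` is then an equivalence.

The converse has two steps. The first one reduces CCZ-equivalence to an identity
`B_{k,s,α} (L p) (L q) = N (B_{ℓ,t,β} p q)` with linear permutations `L` and `N`; it works for all
quadratic APN functions in dimension at least four (`IsQuadraticAPN.exists_linearEquiv_of_ccz`). The
graph of a quadratic APN function `f` is permuted regularly by the elementary abelian group of all
maps `(x, y) ↦ (x + a, y + B x a + f a)`. A linear algebra argument shows that two such groups on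
the same graph which normalize each other coincide (`IsTranslationGroup.eq_of_normalize`), and it
follows from Sylow's theorem and the growth of normalizers in `2`-groups that any two are conjugate
in the affine automorphism group of the graph (`IsTranslationGroup.exists_conj`). A CCZ-equivalence
may therefore be chosen to match the translation groups of the two functions, and then its linear
part preserves the subspace `0 × V`.

In the second step `L` and `N` are expanded in powers of Frobenius, with exponents in `ZMod m`. Let
`(a i, c i)` and `(b i, d i)` be the coefficient vectors of `x ^ 2 ^ i` and `y ^ 2 ^ i` in
`L (x, y)`. The second component of `B_{k,s,α}` is a determinant, while only few monomials occur in
`B_{ℓ,t,β}`. So `(a i, c i)` and `(a j, c j)` are proportional unless `i - j = ± ℓ`, the same holds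
for the `(b i, d i)`, and `(a i, c i)` and `(b j, d j)` are proportional unless `i = j`. As `L` is
bijective, the latter two vectors are independent for some `i = j`, and then all other coefficients
vanish, except possibly at `i ± ℓ` and only when `t = 0`. With so few coefficients left, the first
component of the identity forces `k = ± ℓ` and `s = ± t` modulo `m`, hence `k = ℓ` and `s = t`. When
`t = 0` and `s ≠ 0`, the same argument is applied to the inverse equivalence.
-/

open Module

/-! ### Translation groups -/

/-- `T` is a group of affine permutations of `U` preserving `Γ` that looks, modulo an affine change
of coordinates, like the group of all `(x, y) ↦ (x + a, y + B x a + f a)` acting on the graph `Γ` of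
a quadratic APN function `f : V → V` with polar form `B`, with `W = 0 × V`. The element `τ` of `T`
is labelled by the class of `τ 0` modulo `W` (the parameter `a`), by which it translates `U / W`.
The field `fixed` is the APN property: the linear part of a non-trivial `τ` fixes only `W + ⟨τ 0⟩`.
-/
structure IsTranslationGroup {U : Type*} [AddCommGroup U] [Module (ZMod 2) U] (Γ : Set U)
    (T : Subgroup (U ≃ᵃ[ZMod 2] U)) (W : Submodule (ZMod 2) U) : Prop where
  mapsTo : ∀ τ ∈ T, ∀ p ∈ Γ, τ p ∈ Γ
  injOn : ∀ p ∈ Γ, ∀ q ∈ Γ, p - q ∈ W → p = q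
  linear_sub_mem : ∀ τ ∈ T, ∀ u, τ.linear u - u ∈ W
  linear_fix : ∀ τ ∈ T, ∀ w ∈ W, τ.linear w = w
  exists_apply_zero : ∀ c : U, ∃ τ ∈ T, τ 0 - c ∈ W
  eq_one : ∀ τ ∈ T, τ 0 ∈ W → τ = 1
  fixed : ∀ τ ∈ T, τ ≠ 1 → ∀ u, τ.linear u = u → u ∈ W ∨ u - τ 0 ∈ W
  finrank_eq : finrank (ZMod 2) U = 2 * finrank (ZMod 2) W

theorem AffineEquiv.apply_eq_linear_add {U : Type*} [AddCommGroup U] [Module (ZMod 2) U]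
    (g : U ≃ᵃ[ZMod 2] U) (u v : U) : g u = g.linear (u - v) + g v := by
  have := g.map_vadd v (u - v)
  simpa using this

theorem Submodule.finrank_sup_span_singleton_le {U : Type*} [AddCommGroup U] [Module (ZMod 2) U]
    [Finite U] (W : Submodule (ZMod 2) U) (v : U) :
    finrank (ZMod 2) ↥(W ⊔ Submodule.span (ZMod 2) {v}) ≤ finrank (ZMod 2) W + 1 := by
  refine (Submodule.finrank_add_le_finrank_add_finrank W _).trans ?_
  have := finrank_span_le_card (R := ZMod 2) ({v} : Set U)
  simpa using this

/-- If `A ∩ B` has index at most two in `A`, one vector suffices to generate `A` modulo `B`. -/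
theorem Submodule.exists_le_sup_span_singleton {U : Type*} [AddCommGroup U] [Module (ZMod 2) U]
    (A B : Submodule (ZMod 2) U) (h : ∀ x ∈ A, ∀ y ∈ A, x ∉ B → y ∉ B → x - y ∈ B) :
    ∃ v, A ≤ B ⊔ Submodule.span (ZMod 2) {v} := by
  by_cases hAB : A ≤ B
  · exact ⟨0, hAB.trans le_sup_left⟩
  · obtain ⟨v, hv, hvB⟩ := SetLike.not_le_iff_exists.mp hAB
    refine ⟨v, fun x hx => ?_⟩
    by_cases hxB : x ∈ B
    · exact Submodule.mem_sup_left hxB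
    · rw [← sub_add_cancel x v]
      exact Submodule.add_mem_sup (h x hx v hv hxB hvB) (Submodule.mem_span_singleton_self v)

theorem Submodule.sub_mem_of_finrank_le {U : Type*} [AddCommGroup U] [Module (ZMod 2) U]
    [Finite U] {H W : Submodule (ZMod 2) U} (hHW : H ≤ W)
    (hf : finrank (ZMod 2) W ≤ finrank (ZMod 2) H + 1) {x y : U} (hx : x ∈ W) (hy : y ∈ W)
    (hxH : x ∉ H) (hyH : y ∉ H) : x - y ∈ H := by
  have hlt : H < H ⊔ Submodule.span (ZMod 2) {y} :=
    lt_of_le_of_ne le_sup_left fun e => hyH (by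
      rw [e]
      exact Submodule.mem_sup_right (Submodule.mem_span_singleton_self y))
  have h1 := Submodule.finrank_lt_finrank_of_lt hlt
  have hle : H ⊔ Submodule.span (ZMod 2) {y} ≤ W :=
    sup_le hHW ((Submodule.span_singleton_le_iff_mem y W).mpr hy)
  have he := Submodule.eq_of_le_of_finrank_le hle (by omega)
  rw [← he, Submodule.mem_sup] at hx
  obtain ⟨a, ha, b, hb, rfl⟩ := hx
  obtain ⟨c, rfl⟩ := Submodule.mem_span_singleton.mp hb
  rcases (by decide : ∀ c : ZMod 2, c = 0 ∨ c = 1) c with rfl | rfl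
  · exact absurd (by rwa [zero_smul, add_zero]) hxH
  · rwa [one_smul, add_sub_cancel_right]

namespace IsTranslationGroup

variable {U : Type*} [AddCommGroup U] [Module (ZMod 2) U] {Γ : Set U}
  {T T₁ T₂ : Subgroup (U ≃ᵃ[ZMod 2] U)} {W W₁ W₂ : Submodule (ZMod 2) U}

theorem apply_sub_mem (h : IsTranslationGroup Γ T W) {τ : U ≃ᵃ[ZMod 2] U} (hτ : τ ∈ T) (u : U) :
    τ u - (u + τ 0) ∈ W := by
  have h1 := h.linear_sub_mem τ hτ u
  have h2 := τ.apply_eq_linear_add u 0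
  rw [sub_zero] at h2
  rw [h2]
  convert h1 using 1
  abel

theorem eq_of_sub_mem (h : IsTranslationGroup Γ T W) {τ ρ : U ≃ᵃ[ZMod 2] U} (hτ : τ ∈ T)
    (hρ : ρ ∈ T) (hd : τ 0 - ρ 0 ∈ W) : τ = ρ := by
  have h1 : ρ⁻¹ * τ = 1 := by
    refine h.eq_one _ (T.mul_mem (T.inv_mem hρ) hτ) ?_
    have h2 := (ρ⁻¹).apply_eq_linear_add (τ 0) (ρ 0)
    have h3 : ρ⁻¹ (ρ 0) = 0 := ρ.symm_apply_apply 0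
    rw [h.linear_fix _ (T.inv_mem hρ) _ hd, h3, add_zero] at h2
    rw [AffineEquiv.mul_def, AffineEquiv.trans_apply, h2]
    exact hd
  exact (inv_mul_eq_one.mp h1).symm

theorem exists_apply_eq (h : IsTranslationGroup Γ T W) {p q : U} (hp : p ∈ Γ) (hq : q ∈ Γ) :
    ∃ τ ∈ T, τ p = q := by
  obtain ⟨τ, hτ, hc⟩ := h.exists_apply_zero (q - p)
  refine ⟨τ, hτ, h.injOn _ (h.mapsTo τ hτ p hp) _ hq ?_⟩
  convert W.add_mem (h.apply_sub_mem hτ p) hc using 1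
  abel

theorem mul_apply_zero_sub_mem (h : IsTranslationGroup Γ T W) {τ ρ : U ≃ᵃ[ZMod 2] U} (hτ : τ ∈ T) :
    (τ * ρ) 0 - (τ 0 + ρ 0) ∈ W := by
  rw [AffineEquiv.mul_def, AffineEquiv.trans_apply, add_comm (τ 0)]
  exact h.apply_sub_mem hτ _

theorem mul_comm_of_mem (h : IsTranslationGroup Γ T W) {τ ρ : U ≃ᵃ[ZMod 2] U} (hτ : τ ∈ T)
    (hρ : ρ ∈ T) : τ * ρ = ρ * τ := by
  refine h.eq_of_sub_mem (T.mul_mem hτ hρ) (T.mul_mem hρ hτ) ?_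
  convert W.sub_mem (h.mul_apply_zero_sub_mem (ρ := ρ) hτ) (h.mul_apply_zero_sub_mem (ρ := τ) hρ)
    using 1
  abel

theorem isPGroup (h : IsTranslationGroup Γ T W) : IsPGroup 2 T := by
  rintro ⟨τ, hτ⟩
  refine ⟨1, Subtype.ext (h.eq_one _ (T.pow_mem hτ _) ?_)⟩
  have h1 := h.mul_apply_zero_sub_mem (ρ := τ) hτ
  rw [ZModModule.add_self, sub_zero] at h1
  simpa [pow_two] using h1

/-- A transitive abelian permutation group is its own centralizer, and an affine map is determined
by its values on `Γ`. -/
theorem mem_of_commute (h : IsTranslationGroup Γ T W) (hne : Γ.Nonempty)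
    (hΓ : ∀ g : U ≃ᵃ[ZMod 2] U, (∀ p ∈ Γ, g p = p) → g = 1) {g : U ≃ᵃ[ZMod 2] U}
    (hg : ∀ p ∈ Γ, g p ∈ Γ) (hc : ∀ τ ∈ T, g * τ = τ * g) : g ∈ T := by
  obtain ⟨p, hp⟩ := hne
  obtain ⟨τ, hτ, he⟩ := h.exists_apply_eq hp (hg p hp)
  have h1 : τ⁻¹ * g = 1 := by
    refine hΓ _ fun q hq => ?_
    obtain ⟨ρ, hρ, rfl⟩ := h.exists_apply_eq hp hq
    have h2 : g (ρ p) = τ (ρ p) := by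
      have h3 := congrArg (fun z : U ≃ᵃ[ZMod 2] U => z p) (hc ρ hρ)
      have h4 := congrArg (fun z : U ≃ᵃ[ZMod 2] U => z p) (h.mul_comm_of_mem hτ hρ)
      simp only [AffineEquiv.mul_def, AffineEquiv.trans_apply] at h3 h4
      rw [h3, h4, he]
    rw [AffineEquiv.mul_def, AffineEquiv.trans_apply, h2]
    exact τ.symm_apply_apply _
  rw [← inv_mul_eq_one.mp h1]
  exact hτ

theorem le_of_same_submodule (h₁ : IsTranslationGroup Γ T₁ W) (h₂ : IsTranslationGroup Γ T₂ W)
    (hΓ : ∀ g : U ≃ᵃ[ZMod 2] U, (∀ p ∈ Γ, g p = p) → g = 1) : T₂ ≤ T₁ := by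
  intro σ hσ
  obtain ⟨τ, hτ, hc⟩ := h₁.exists_apply_zero (σ 0)
  have h1 : τ⁻¹ * σ = 1 := by
    refine hΓ _ fun q hq => ?_
    have h2 : τ q = σ q := by
      refine h₁.injOn _ (h₁.mapsTo τ hτ q hq) _ (h₂.mapsTo σ hσ q hq) ?_
      convert W.add_mem (W.sub_mem (h₁.apply_sub_mem hτ q) (h₂.apply_sub_mem hσ q)) hc using 1
      abel
    rw [AffineEquiv.mul_def, AffineEquiv.trans_apply, ← h2]
    exact τ.symm_apply_apply _
  rw [← inv_mul_eq_one.mp h1]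
  exact hτ

/-- A translation group determines `W`: a vector `v` fixed by all its linear parts but lying outside
`W₁` would have to be congruent to `τ 0` modulo `W₁` for every non-trivial `τ`. -/
theorem submodule_unique [Finite U] (h₁ : IsTranslationGroup Γ T W₁)
    (h₂ : IsTranslationGroup Γ T W₂) (hU : 3 ≤ finrank (ZMod 2) U) : W₁ = W₂ := by
  have hf : finrank (ZMod 2) W₁ = finrank (ZMod 2) W₂ := by
    have := h₁.finrank_eq
    have := h₂.finrank_eq
    omega
  symm
  refine Submodule.eq_of_le_of_finrank_eq (fun v hv => ?_) hf.symm
  by_contra hv1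
  have htop : (⊤ : Submodule (ZMod 2) U) ≤ W₁ ⊔ Submodule.span (ZMod 2) {v} := by
    intro c _
    obtain ⟨τ, hτ, hc⟩ := h₁.exists_apply_zero c
    by_cases h1 : τ = 1
    · subst h1
      refine Submodule.mem_sup_left ?_
      simpa using hc
    · have h2 := (h₁.fixed τ hτ h1 v (h₂.linear_fix τ hτ v hv)).resolve_left hv1
      have h3 : c - v ∈ W₁ := by
        convert W₁.neg_mem (W₁.add_mem hc h2) using 1
        abel
      rw [← sub_add_cancel c v]
      exact Submodule.add_mem_sup h3 (Submodule.mem_span_singleton_self v)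
  have h1 := Submodule.finrank_mono htop
  have h2 := W₁.finrank_sup_span_singleton_le v
  rw [finrank_top] at h1
  have := h₁.finrank_eq
  omega

theorem conj (h : IsTranslationGroup Γ T W) (g : U ≃ᵃ[ZMod 2] U) :
    IsTranslationGroup (g '' Γ) (T.map (MulAut.conj g).toMonoidHom)
      (W.map (g.linear : U →ₗ[ZMod 2] U)) := by
  have hmem : ∀ v, v ∈ W.map (g.linear : U →ₗ[ZMod 2] U) ↔ g.linear.symm v ∈ W := by
    intro v
    constructor
    · rintro ⟨w, hw, rfl⟩
      simpa using hw
    · intro hv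
      exact ⟨_, hv, by simp⟩
  have happ : ∀ τ : U ≃ᵃ[ZMod 2] U, ∀ v, (g * τ * g⁻¹) v = g (τ (g.symm v)) := fun _ _ => rfl
  have hlin : ∀ τ : U ≃ᵃ[ZMod 2] U, ∀ v,
      (g * τ * g⁻¹).linear v = g.linear (τ.linear (g.linear.symm v)) := fun _ _ => rfl
  have hz : ∀ τ ∈ T, g.linear.symm ((g * τ * g⁻¹) 0) - τ 0 ∈ W := by
    intro τ hτ
    have h1 := g.apply_eq_linear_add (τ (g.symm 0)) (g.symm 0)
    rw [g.apply_symm_apply, add_zero] at h1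
    rw [happ, h1, LinearEquiv.symm_apply_apply]
    convert h.apply_sub_mem hτ (g.symm 0) using 1
    abel
  constructor
  · rintro _ ⟨τ, hτ, rfl⟩ _ ⟨p, hp, rfl⟩
    refine ⟨τ p, h.mapsTo τ hτ p hp, ?_⟩
    change _ = (g * τ * g⁻¹) (g p)
    rw [happ, g.symm_apply_apply]
  · rintro _ ⟨p, hp, rfl⟩ _ ⟨q, hq, rfl⟩ hpq
    rw [hmem, g.apply_eq_linear_add p q, add_sub_cancel_right, LinearEquiv.symm_apply_apply] at hpq
    rw [h.injOn p hp q hq hpq]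
  · rintro _ ⟨τ, hτ, rfl⟩ u
    change (g * τ * g⁻¹).linear u - u ∈ _
    rw [hmem, hlin, map_sub, LinearEquiv.symm_apply_apply]
    exact h.linear_sub_mem τ hτ _
  · rintro _ ⟨τ, hτ, rfl⟩ w hw
    change (g * τ * g⁻¹).linear w = w
    rw [hlin, h.linear_fix τ hτ _ ((hmem w).mp hw), LinearEquiv.apply_symm_apply]
  · intro c
    obtain ⟨τ, hτ, hc⟩ := h.exists_apply_zero (g.linear.symm c)
    refine ⟨_, ⟨τ, hτ, rfl⟩, ?_⟩
    change (g * τ * g⁻¹) 0 - c ∈ _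
    rw [hmem, map_sub]
    convert W.add_mem (hz τ hτ) hc using 1
    abel
  · rintro _ ⟨τ, hτ, rfl⟩ h0
    change (g * τ * g⁻¹) 0 ∈ _ at h0
    rw [hmem] at h0
    rw [h.eq_one τ hτ, map_one]
    convert W.sub_mem h0 (hz τ hτ) using 1
    abel
  · rintro _ ⟨τ, hτ, rfl⟩ h1 u hu
    change (g * τ * g⁻¹).linear u = u at hu
    change _ ∨ u - (g * τ * g⁻¹) 0 ∈ _
    rw [hlin] at hu
    have h2 : τ.linear (g.linear.symm u) = g.linear.symm u := by
      rw [LinearEquiv.eq_symm_apply, hu]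
    rw [hmem, hmem, map_sub]
    refine (h.fixed τ hτ (fun e => h1 (by rw [e, map_one])) _ h2).imp id fun h3 => ?_
    convert W.sub_mem h3 (hz τ hτ) using 1
    abel
  · rw [h.finrank_eq]
    congr 1
    exact (LinearEquiv.finrank_map_eq g.linear W).symm

end IsTranslationGroup

/-! ### Conjugacy of translation groups -/

namespace IsTranslationGroup
variable {U : Type*} [AddCommGroup U] [Module (ZMod 2) U] {Γ : Set U}
  {T T₁ T₂ : Subgroup (U ≃ᵃ[ZMod 2] U)} {W W₁ W₂ : Submodule (ZMod 2) U}

theorem image_eq (h : IsTranslationGroup Γ T W) {τ : U ≃ᵃ[ZMod 2] U} (hτ : τ ∈ T) :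
    τ '' Γ = Γ := by
  apply Set.Subset.antisymm
  · rintro _ ⟨p, hp, rfl⟩
    exact h.mapsTo τ hτ p hp
  · intro p hp
    exact ⟨τ⁻¹ p, h.mapsTo _ (T.inv_mem hτ) p hp, τ.apply_symm_apply p⟩

/-- Suppose that `σ ∈ T₂` lies outside `T₁`. It fails to commute with some `τ ∈ T₁`, and the
commutator `d` lies in `T₁ ∩ T₂`, so the image of `d.linear - 1`, which has codimension one in `W₁`
and in `W₂`, is contained in `W₁ ∩ W₂`. Therefore `σ.linear - 1` has rank at most one modulo `W₁`,
and its restriction to `W₁` also has rank at most one. Comparing the linear parts of `σ τ` and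
`d τ σ` bounds the rank of `d.linear - 1` by two, which is too small if `U` is large. -/
theorem le_of_normalize [Finite U] (h₁ : IsTranslationGroup Γ T₁ W₁)
    (h₂ : IsTranslationGroup Γ T₂ W₂) (hne : Γ.Nonempty)
    (hΓ : ∀ g : U ≃ᵃ[ZMod 2] U, (∀ p ∈ Γ, g p = p) → g = 1) (hU : 8 ≤ finrank (ZMod 2) U)
    (hn₁ : ∀ σ ∈ T₂, ∀ τ ∈ T₁, σ * τ * σ⁻¹ ∈ T₁) (hn₂ : ∀ τ ∈ T₁, ∀ σ ∈ T₂, τ * σ * τ⁻¹ ∈ T₂) :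
    T₂ ≤ T₁ := by
  by_contra hle
  obtain ⟨σ, hσ, hσ1⟩ := SetLike.not_le_iff_exists.mp hle
  have hW : W₁ ≠ W₂ := by
    rintro rfl
    exact hle (h₁.le_of_same_submodule h₂ hΓ)
  have hf : finrank (ZMod 2) W₁ = finrank (ZMod 2) W₂ := by
    have := h₁.finrank_eq
    have := h₂.finrank_eq
    omega
  obtain ⟨τ, hτ, hστ⟩ : ∃ τ ∈ T₁, σ * τ ≠ τ * σ := by
    by_contra! hc
    exact hσ1 (h₁.mem_of_commute hne hΓ (h₂.mapsTo σ hσ) hc)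
  set d := σ * τ * σ⁻¹ * τ⁻¹ with hd
  have hd1 : d ∈ T₁ := T₁.mul_mem (hn₁ σ hσ τ hτ) (T₁.inv_mem hτ)
  have hd2 : d ∈ T₂ := by
    have := T₂.mul_mem hσ (hn₂ τ hτ _ (T₂.inv_mem hσ))
    simpa [hd, mul_assoc] using this
  have hdne : d ≠ 1 := by
    intro h
    apply hστ
    rw [hd, mul_inv_eq_one, mul_inv_eq_iff_eq_mul] at h
    exact h
  have hdτ : ∀ u, σ.linear (τ.linear u) = d.linear (τ.linear (σ.linear u)) := by
    intro u
    have h1 : σ * τ = d * τ * σ := by rw [hd]; group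
    have h2 := congrArg (fun g : U ≃ᵃ[ZMod 2] U => g.linear u) h1
    exact h2
  -- The kernel of `δ` is the fixed space of `d`, which the APN property bounds from above.
  set δ : U →ₗ[ZMod 2] U := (d.linear : U →ₗ[ZMod 2] U) - LinearMap.id with hδ
  have hδapp : ∀ u, δ u = d.linear u - u := fun _ => rfl
  have hker : LinearMap.ker δ ≤ W₁ ⊔ Submodule.span (ZMod 2) {d 0} := by
    intro u hu
    rw [LinearMap.mem_ker, hδapp, sub_eq_zero] at hu
    rcases h₁.fixed d hd1 hdne u hu with h | h
    · exact Submodule.mem_sup_left h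
    · rw [← sub_add_cancel u (d 0)]
      exact Submodule.add_mem_sup h (Submodule.mem_span_singleton_self _)
  have hrange : LinearMap.range δ ≤ W₁ ⊓ W₂ := by
    rintro _ ⟨u, rfl⟩
    exact ⟨h₁.linear_sub_mem d hd1 u, h₂.linear_sub_mem d hd2 u⟩
  have hH : finrank (ZMod 2) W₁ ≤ finrank (ZMod 2) ↥(W₁ ⊓ W₂) + 1 := by
    have e1 := Submodule.finrank_mono hker
    have e2 := Submodule.finrank_mono hrange
    have e3 := W₁.finrank_sup_span_singleton_le (d 0)
    have e4 := δ.finrank_range_add_finrank_ker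
    have := h₁.finrank_eq
    omega
  -- `K`, the space of vectors moved by `σ` within their coset of `W₁`, has codimension at most one,
  -- since `σ` moves vectors by elements of `W₂`, and `W₁ ∩ W₂` has index two in `W₂`.
  set K : Submodule (ZMod 2) U :=
    W₁.comap ((σ.linear : U →ₗ[ZMod 2] U) - LinearMap.id) with hK
  have hKmem : ∀ u, u ∈ K ↔ σ.linear u - u ∈ W₁ := fun _ => Iff.rfl
  obtain ⟨u₀, hu₀⟩ := Submodule.exists_le_sup_span_singleton ⊤ K (by
    intro x _ y _ hx hy
    rw [hKmem] at hx hy ⊢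
    have h3 := Submodule.sub_mem_of_finrank_le (H := W₁ ⊓ W₂) inf_le_right (by omega)
      (h₂.linear_sub_mem σ hσ x) (h₂.linear_sub_mem σ hσ y) (fun h => hx h.1) (fun h => hy h.1)
    have h4 : σ.linear x - x - (σ.linear y - y) ∈ W₁ := h3.1
    rw [map_sub]
    convert h4 using 1
    abel)
  -- On `K`, the map `δ` factors through the restriction of `σ.linear - 1` to `W₁`, which kills
  -- `W₁ ∩ W₂`.
  have hmove : ∀ y ∈ K, δ y = σ.linear (τ.linear y - y) - (τ.linear y - y) := by
    intro y hy
    rw [hKmem] at hy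
    have e1 := hdτ y
    have e2 := h₁.linear_fix τ hτ _ hy
    have e3 := h₁.linear_fix d hd1 _ hy
    have e4 := h₁.linear_fix d hd1 _ (h₁.linear_sub_mem τ hτ y)
    rw [map_sub] at e2 e3 e4
    have e5 : τ.linear (σ.linear y) = τ.linear y + (σ.linear y - y) := by rw [← e2]; abel
    rw [hδapp, map_sub, e1, e5, map_add, map_sub]
    have e6 : d.linear (τ.linear y) = d.linear y + (τ.linear y - y) := by rw [← e4]; abel
    rw [e3, e6]
    abel
  obtain ⟨y₀, hy₀⟩ := Submodule.exists_le_sup_span_singleton K (LinearMap.ker δ) (by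
    intro x hx y hy hxk hyk
    rw [LinearMap.mem_ker] at hxk hyk ⊢
    rw [hmove x hx] at hxk
    rw [hmove y hy] at hyk
    have hfix : ∀ z ∈ W₁ ⊓ W₂, σ.linear z - z = 0 := fun z hz => by
      rw [h₂.linear_fix σ hσ z hz.2, sub_self]
    have h3 := Submodule.sub_mem_of_finrank_le (H := W₁ ⊓ W₂) inf_le_left hH
      (h₁.linear_sub_mem τ hτ x) (h₁.linear_sub_mem τ hτ y)
      (fun h => hxk (hfix _ h)) (fun h => hyk (hfix _ h))
    have h4 := hfix _ h3
    rw [map_sub] at h4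
    rw [map_sub, hmove x hx, hmove y hy, ← h4]
    abel)
  -- Altogether `U` is generated by `W₁` and the three vectors `d 0`, `y₀`, `u₀`.
  have e1 := Submodule.finrank_mono hu₀
  have e2 := K.finrank_sup_span_singleton_le u₀
  have e3 := Submodule.finrank_mono hy₀
  have e4 := (LinearMap.ker δ).finrank_sup_span_singleton_le y₀
  have e5 := Submodule.finrank_mono hker
  have e6 := W₁.finrank_sup_span_singleton_le (d 0)
  rw [finrank_top] at e1
  have := h₁.finrank_eq
  omega

theorem eq_of_normalize [Finite U] (h₁ : IsTranslationGroup Γ T₁ W₁)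
    (h₂ : IsTranslationGroup Γ T₂ W₂) (hne : Γ.Nonempty)
    (hΓ : ∀ g : U ≃ᵃ[ZMod 2] U, (∀ p ∈ Γ, g p = p) → g = 1) (hU : 8 ≤ finrank (ZMod 2) U)
    (hn₁ : ∀ σ ∈ T₂, ∀ τ ∈ T₁, σ * τ * σ⁻¹ ∈ T₁) (hn₂ : ∀ τ ∈ T₁, ∀ σ ∈ T₂, τ * σ * τ⁻¹ ∈ T₂) :
    T₁ = T₂ :=
  le_antisymm (h₂.le_of_normalize h₁ hne hΓ hU hn₂ hn₁) (h₁.le_of_normalize h₂ hne hΓ hU hn₁ hn₂)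

end IsTranslationGroup

/-- In a finite group, let `P` be a conjugation-invariant class of `p`-subgroups in which two
members that normalize each other are equal. Then all members are conjugate: a member contained in a
Sylow subgroup `Q` is normal in `Q`, as otherwise an element of `Q` normalizing its normalizer in
`Q` conjugates it to a different member, and the two normalize each other. -/
theorem exists_conj_eq_of_normalizing_eq {G : Type*} [Group G] [Finite G] (p : ℕ) [Fact p.Prime]
    (P : Subgroup G → Prop) (hp : ∀ T, P T → IsPGroup p T)
    (hconj : ∀ T, P T → ∀ g : G, P (T.map (MulAut.conj g).toMonoidHom))
    (heq : ∀ T₁ T₂, P T₁ → P T₂ → T₁ ≤ Subgroup.normalizer (T₂ : Set G) →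
      T₂ ≤ Subgroup.normalizer (T₁ : Set G) → T₁ = T₂)
    {T₁ T₂ : Subgroup G} (h₁ : P T₁) (h₂ : P T₂) :
    ∃ g : G, T₁.map (MulAut.conj g).toMonoidHom = T₂ := by
  have key : ∀ T, P T → ∀ Q : Sylow p G, T ≤ Q →
      (Q : Subgroup G) ≤ Subgroup.normalizer (T : Set G) := by
    intro T hT Q hTQ
    by_contra hQ
    set N : Subgroup Q := (Subgroup.normalizer (T : Set G)).subgroupOf Q with hN
    have hTN : ∀ t (ht : t ∈ T), (⟨t, hTQ ht⟩ : Q) ∈ N := fun t ht => by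
      rw [hN, Subgroup.mem_subgroupOf]
      exact Subgroup.le_normalizer ht
    have hlt : N < ⊤ := by
      rw [lt_top_iff_ne_top, hN, Ne, Subgroup.subgroupOf_eq_top]
      exact hQ
    have : Group.IsNilpotent Q := Q.isPGroup'.isNilpotent
    have h1 := Group.normalizerCondition_of_isNilpotent (G := Q) N hlt
    obtain ⟨g, hgN, hg⟩ := SetLike.exists_of_lt h1
    apply hg
    rw [hN, Subgroup.mem_subgroupOf, Subgroup.mem_normalizer_iff_map_conj_eq]
    refine heq _ _ (hconj T hT _) hT ?_ ?_
    · rintro _ ⟨t, ht, rfl⟩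
      have h2 := (Subgroup.mem_normalizer_iff.mp hgN _).mp (hTN t ht)
      rw [hN, Subgroup.mem_subgroupOf] at h2
      exact h2
    · intro t ht
      have h2 := (Subgroup.mem_normalizer_iff.mp (inv_mem hgN) _).mp (hTN t ht)
      rw [hN, Subgroup.mem_subgroupOf] at h2
      have h3 := Subgroup.map_equiv_normalizer_eq T (MulAut.conj (g : G))
      rw [SetLike.ext_iff] at h3
      refine (h3 t).mp ⟨_, h2, ?_⟩
      simp [mul_assoc]
  obtain ⟨Q₁, hQ₁⟩ := (hp T₁ h₁).exists_le_sylow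
  obtain ⟨Q₂, hQ₂⟩ := (hp T₂ h₂).exists_le_sylow
  obtain ⟨g, hg⟩ := MulAction.exists_smul_eq G Q₁ Q₂
  refine ⟨g, ?_⟩
  have hle : T₁.map (MulAut.conj g).toMonoidHom ≤ Q₂ := by
    rw [← hg]
    exact Subgroup.map_mono hQ₁
  exact heq _ _ (hconj T₁ h₁ g) h₂ (hle.trans (key T₂ h₂ Q₂ hQ₂))
    (hQ₂.trans (key _ (hconj T₁ h₁ g) Q₂ hle))

namespace IsTranslationGroup
variable {U : Type*} [AddCommGroup U] [Module (ZMod 2) U] {Γ : Set U}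
  {T T₁ T₂ : Subgroup (U ≃ᵃ[ZMod 2] U)} {W W₁ W₂ : Submodule (ZMod 2) U}

/-- Any two translation groups of `Γ` are conjugate under the affine automorphism group of `Γ`. -/
theorem exists_conj [Finite U] (h₁ : IsTranslationGroup Γ T₁ W₁)
    (h₂ : IsTranslationGroup Γ T₂ W₂) (hne : Γ.Nonempty)
    (hΓ : ∀ g : U ≃ᵃ[ZMod 2] U, (∀ p ∈ Γ, g p = p) → g = 1) (hU : 8 ≤ finrank (ZMod 2) U) :
    ∃ g : U ≃ᵃ[ZMod 2] U, g '' Γ = Γ ∧ W₁.map (g.linear : U →ₗ[ZMod 2] U) = W₂ := by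
  have : Finite (U ≃ᵃ[ZMod 2] U) := Finite.of_injective _ DFunLike.coe_injective
  let G : Subgroup (U ≃ᵃ[ZMod 2] U) :=
    { carrier := {g | g '' Γ = Γ}
      one_mem' := Set.image_id Γ
      mul_mem' := by
        intro a b ha hb
        change (a ∘ b) '' Γ = Γ
        rw [Set.image_comp, show b '' Γ = Γ from hb, show a '' Γ = Γ from ha]
      inv_mem' := by
        intro a ha
        change a.symm '' Γ = Γ
        conv_lhs => rw [← show a '' Γ = Γ from ha]
        rw [← Set.image_comp]
        simp }
  have hG : ∀ {T W}, IsTranslationGroup Γ T W → T ≤ G := fun h τ hτ => h.image_eq hτ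
  let P : Subgroup G → Prop := fun T => ∃ W, IsTranslationGroup Γ (T.map G.subtype) W
  have hP : ∀ {T W}, IsTranslationGroup Γ T W → P (T.subgroupOf G) := fun {T W} h =>
    ⟨W, by rwa [Subgroup.map_subgroupOf_eq_of_le (hG h)]⟩
  have hconj : ∀ (T : Subgroup G) (g : G), (T.map (MulAut.conj g).toMonoidHom).map G.subtype =
      (T.map G.subtype).map (MulAut.conj (g : U ≃ᵃ[ZMod 2] U)).toMonoidHom := by
    intro T g
    rw [Subgroup.map_map, Subgroup.map_map]
    rfl
  obtain ⟨g, hg⟩ := exists_conj_eq_of_normalizing_eq 2 P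
    (fun T ⟨W, h⟩ => h.isPGroup.of_equiv (T.equivMapOfInjective _ G.subtype_injective).symm)
    (fun T ⟨W, h⟩ g => ⟨_, by
      rw [hconj]
      have := h.conj (g : U ≃ᵃ[ZMod 2] U)
      rwa [show (g : U ≃ᵃ[ZMod 2] U) '' Γ = Γ from g.2] at this⟩)
    (by
      rintro S₁ S₂ ⟨_, k₁⟩ ⟨_, k₂⟩ hn₁ hn₂
      refine Subgroup.map_injective G.subtype_injective (k₁.eq_of_normalize k₂ hne hΓ hU ?_ ?_)
      · rintro _ ⟨σ, hσ, rfl⟩ _ ⟨τ, hτ, rfl⟩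
        exact ⟨_, (Subgroup.mem_normalizer_iff.mp (hn₂ hσ) τ).mp hτ, rfl⟩
      · rintro _ ⟨σ, hσ, rfl⟩ _ ⟨τ, hτ, rfl⟩
        exact ⟨_, (Subgroup.mem_normalizer_iff.mp (hn₁ hσ) τ).mp hτ, rfl⟩)
    (hP h₁) (hP h₂)
  refine ⟨g, g.2, ?_⟩
  have h3 := congrArg (Subgroup.map G.subtype) hg
  rw [hconj, Subgroup.map_subgroupOf_eq_of_le (hG h₁), Subgroup.map_subgroupOf_eq_of_le (hG h₂)]
    at h3
  have h4 := h₁.conj (g : U ≃ᵃ[ZMod 2] U)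
  rw [h3, show (g : U ≃ᵃ[ZMod 2] U) '' Γ = Γ from g.2] at h4
  exact h4.submodule_unique h₂ (by omega)

end IsTranslationGroup

/-! ### CCZ-equivalence of quadratic APN functions -/

/-- `f` is quadratic with polar form `B` (and `f 0 = 0`), it is almost perfect nonlinear, and the
values of `B` span `V`. -/
structure IsQuadraticAPN {V : Type*} [AddCommGroup V] [Module (ZMod 2) V] (f : V → V)
    (B : V →ₗ[ZMod 2] V →ₗ[ZMod 2] V) : Prop where
  map_add : ∀ x y, f (x + y) = f x + f y + B x y
  eq_of_eq_zero : ∀ x a, B x a = 0 → a = 0 ∨ x = 0 ∨ x = a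
  span : ∀ φ : V →ₗ[ZMod 2] V, (∀ x a, φ (B x a) = 0) → φ = 0

namespace IsQuadraticAPN
variable {V : Type*} [AddCommGroup V] [Module (ZMod 2) V] {f g : V → V}
    {B B' : V →ₗ[ZMod 2] V →ₗ[ZMod 2] V}

theorem map_zero (h : IsQuadraticAPN f B) : f 0 = 0 := by
  have := h.map_add 0 0
  simpa using this

theorem self (h : IsQuadraticAPN f B) (x : V) : B x x = 0 := by
  have := h.map_add x x
  rw [ZModModule.add_self, ZModModule.add_self, zero_add, h.map_zero] at this
  exact this.symm

/-- The maps `(x, y) ↦ (x + a, y + B x a + f a)`, a group permuting the graph of `f` regularly. -/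
def translations (h : IsQuadraticAPN f B) : Subgroup ((V × V) ≃ᵃ[ZMod 2] (V × V)) where
  carrier := {τ | ∃ a, ∀ x y, τ (x, y) = (x + a, y + B x a + f a)}
  one_mem' := ⟨0, fun x y => by simp [h.map_zero]⟩
  mul_mem' := by
    rintro τ ρ ⟨a, ha⟩ ⟨b, hb⟩
    refine ⟨b + a, fun x y => ?_⟩
    rw [AffineEquiv.mul_def, AffineEquiv.trans_apply, hb, ha, h.map_add b a, _root_.map_add,
      _root_.map_add, LinearMap.add_apply]
    refine Prod.ext ?_ ?_
    · exact add_assoc _ _ _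
    · change y + B x b + f b + (B x a + B b a) + f a = y + (B x b + B x a) + (f b + f a + B b a)
      abel
  inv_mem' := by
    rintro τ ⟨a, ha⟩
    refine ⟨a, fun x y => ?_⟩
    have h1 : τ (x + a, y + B x a + f a) = (x, y) := by
      rw [ha, _root_.map_add, LinearMap.add_apply, h.self]
      refine Prod.ext ?_ ?_
      · change x + a + a = x
        rw [add_assoc, ZModModule.add_self, add_zero]
      · change y + B x a + f a + (B x a + 0) + f a = y
        have h2 : y + B x a + f a + (B x a + 0) + f a = y + (B x a + B x a) + (f a + f a) := by abel
        rw [h2, ZModModule.add_self, ZModModule.add_self, add_zero, add_zero]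
    rw [← h1]
    exact τ.symm_apply_apply _

theorem exists_mem_translations (h : IsQuadraticAPN f B) (a : V) :
    ∃ τ ∈ h.translations, ∀ x y, τ (x, y) = (x + a, y + B x a + f a) := by
  let l : (V × V) →ₗ[ZMod 2] (V × V) :=
    LinearMap.id + (LinearMap.inr (ZMod 2) V V).comp ((B.flip a).comp (LinearMap.fst (ZMod 2) V V))
  have hl : ∀ x y, l (x, y) = (x, y + B x a) := by
    intro x y
    simp [l]
  have hinv : Function.Involutive l := by
    rintro ⟨x, y⟩
    rw [hl, hl, add_assoc, ZModModule.add_self, add_zero]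
  let τ : (V × V) ≃ᵃ[ZMod 2] (V × V) :=
    (LinearEquiv.ofInvolutive l hinv).toAffineEquiv.trans
      (AffineEquiv.constVAdd (ZMod 2) (V × V) (a, f a))
  have hτ : ∀ x y, τ (x, y) = (x + a, y + B x a + f a) := by
    intro x y
    change (a, f a) + l (x, y) = _
    rw [hl, add_comm]
    rfl
  exact ⟨τ, ⟨a, hτ⟩, hτ⟩

theorem isTranslationGroup [Finite V] (h : IsQuadraticAPN f B) :
    IsTranslationGroup (Set.range fun x => (x, f x)) h.translations
      (LinearMap.ker (LinearMap.fst (ZMod 2) V V)) := by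
  have hlin : ∀ (τ : (V × V) ≃ᵃ[ZMod 2] (V × V)) (a : V),
      (∀ x y, τ (x, y) = (x + a, y + B x a + f a)) → ∀ x y, τ.linear (x, y) = (x, y + B x a) := by
    intro τ a ha x y
    have h1 := τ.apply_eq_linear_add (x, y) 0
    rw [sub_zero] at h1
    rw [← sub_eq_iff_eq_add.mpr h1, ha, show τ 0 = _ from ha 0 0]
    simp
  have hmem : ∀ p : V × V, p ∈ LinearMap.ker (LinearMap.fst (ZMod 2) V V) ↔ p.1 = 0 :=
    fun _ => Iff.rfl
  constructor
  · rintro τ ⟨a, ha⟩ _ ⟨x, rfl⟩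
    refine ⟨x + a, ?_⟩
    change (x + a, f (x + a)) = τ (x, f x)
    rw [ha, h.map_add]
    refine Prod.ext rfl ?_
    change f x + f a + B x a = f x + B x a + f a
    abel
  · rintro _ ⟨x, rfl⟩ _ ⟨y, rfl⟩ hxy
    rw [hmem] at hxy
    have : x = y := sub_eq_zero.mp hxy
    rw [this]
  · rintro τ ⟨a, ha⟩ ⟨x, y⟩
    rw [hmem, hlin τ a ha]
    exact sub_self x
  · rintro τ ⟨a, ha⟩ ⟨x, y⟩ hw
    rw [hmem] at hw
    change x = 0 at hw
    rw [hlin τ a ha, hw]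
    simp
  · intro c
    obtain ⟨τ, hτ, ha⟩ := h.exists_mem_translations c.1
    refine ⟨τ, hτ, ?_⟩
    rw [hmem, show τ 0 = _ from ha 0 0]
    simp
  · rintro τ ⟨a, ha⟩ h0
    rw [hmem, show τ 0 = _ from ha 0 0] at h0
    have ha0 : a = 0 := by simpa using h0
    ext1 ⟨x, y⟩
    rw [ha, ha0]
    simp [h.map_zero]
  · rintro τ ⟨a, ha⟩ h1 ⟨x, y⟩ hu
    rw [hlin τ a ha] at hu
    have hB : B x a = 0 := by simpa using hu
    rw [hmem, hmem, show τ 0 = _ from ha 0 0]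
    rcases h.eq_of_eq_zero x a hB with h2 | h2 | h2
    · exfalso
      apply h1
      ext1 ⟨x, y⟩
      rw [ha, h2]
      simp [h.map_zero]
    · exact Or.inl h2
    · right
      simp [h2]
  · have h1 := (LinearMap.fst (ZMod 2) V V).finrank_range_add_finrank_ker
    rw [LinearMap.range_eq_top.mpr Prod.fst_surjective, finrank_top, finrank_prod] at h1
    rw [finrank_prod]
    omega

theorem eq_one_of_fixes (h : IsQuadraticAPN f B) (g : (V × V) ≃ᵃ[ZMod 2] (V × V))
    (hg : ∀ p ∈ Set.range (fun x => (x, f x)), g p = p) : g = 1 := by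
  have hfix : ∀ x, g (x, f x) = (x, f x) := fun x => hg _ ⟨x, rfl⟩
  have h0 : g 0 = 0 := by
    have := hfix 0
    rw [h.map_zero] at this
    exact this
  have hl : ∀ p, g p = g.linear p := by
    intro p
    have := g.apply_eq_linear_add p 0
    rwa [sub_zero, h0, add_zero] at this
  let φ : V →ₗ[ZMod 2] V × V :=
    (g.linear : (V × V) →ₗ[ZMod 2] (V × V)).comp (LinearMap.inr (ZMod 2) V V)
      - LinearMap.inr (ZMod 2) V V
  have hφ : ∀ w, φ w = g.linear (0, w) - (0, w) := fun _ => rfl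
  have hφB : ∀ x a, φ (B x a) = 0 := by
    intro x a
    have h1 : ((0 : V), B x a) = (x + a, f (x + a)) - (x, f x) - (a, f a) := by
      rw [h.map_add]
      ext
      · simp
      · simp
        abel
    rw [hφ, sub_eq_zero, h1, map_sub, map_sub, ← hl, ← hl, ← hl, hfix, hfix, hfix]
  have h1 := h.span ((LinearMap.fst (ZMod 2) V V).comp φ) fun x a => by simp [hφB]
  have h2 := h.span ((LinearMap.snd (ZMod 2) V V).comp φ) fun x a => by simp [hφB]
  have h3 : ∀ w, g.linear (0, w) = (0, w) := by
    intro w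
    rw [← sub_eq_zero, ← hφ]
    exact Prod.ext (LinearMap.congr_fun h1 w) (LinearMap.congr_fun h2 w)
  ext1 ⟨x, y⟩
  have h4 : (x, y) = (x, f x) + (0, y - f x) := by simp
  change _ = (x, y)
  rw [hl, h4, _root_.map_add, ← hl, hfix, h3]

/-- CCZ-equivalent quadratic APN functions are extended affine equivalent. Composing the given map
with an automorphism of the graph of `g`, one may assume that it carries the translation group of
`f` to that of `g`, so that its linear part preserves `0 × V`. -/
theorem exists_linearEquiv_of_ccz [Finite V] (hV : 4 ≤ finrank (ZMod 2) V)
    (hf : IsQuadraticAPN f B) (hg : IsQuadraticAPN g B') (hC : CCZEquivalent f g) :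
    ∃ L N : V ≃ₗ[ZMod 2] V, ∀ x a, B' (L x) (L a) = N (B x a) := by
  obtain ⟨C, hC⟩ := hC
  have h1 := hf.isTranslationGroup.conj C
  rw [hC] at h1
  obtain ⟨D, hD, hDW⟩ := h1.exists_conj hg.isTranslationGroup ⟨_, 0, rfl⟩ hg.eq_one_of_fixes
    (by rw [finrank_prod]; omega)
  let E : (V × V) ≃ᵃ[ZMod 2] (V × V) := C.trans D
  have hE : ∀ x, ∃ z, E (x, f x) = (z, g z) := by
    intro x
    have h2 : D (C (x, f x)) ∈ Set.range fun x => (x, g x) := by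
      rw [← hD, ← hC]
      exact ⟨_, ⟨_, ⟨x, rfl⟩, rfl⟩, rfl⟩
    obtain ⟨z, hz⟩ := h2
    exact ⟨z, hz.symm⟩
  have hEW : ∀ p : V × V, (E.linear p).1 = 0 ↔ p.1 = 0 := by
    intro p
    have h2 := SetLike.ext_iff.mp hDW (E.linear p)
    rw [Submodule.mem_map] at h2
    constructor
    · intro hp
      obtain ⟨_, ⟨q, hq, rfl⟩, he⟩ := h2.mpr hp
      have : q = p := E.linear.injective he
      rw [← this]
      exact hq
    · intro hp
      exact h2.mp ⟨_, ⟨p, hp, rfl⟩, rfl⟩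
  let L₀ : V →ₗ[ZMod 2] V := (LinearMap.fst (ZMod 2) V V).comp
    ((E.linear : (V × V) →ₗ[ZMod 2] (V × V)).comp (LinearMap.inl (ZMod 2) V V))
  let M₀ : V →ₗ[ZMod 2] V := (LinearMap.snd (ZMod 2) V V).comp
    ((E.linear : (V × V) →ₗ[ZMod 2] (V × V)).comp (LinearMap.inl (ZMod 2) V V))
  let N₀ : V →ₗ[ZMod 2] V := (LinearMap.snd (ZMod 2) V V).comp
    ((E.linear : (V × V) →ₗ[ZMod 2] (V × V)).comp (LinearMap.inr (ZMod 2) V V))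
  have hEN : ∀ y, E.linear (0, y) = (0, N₀ y) := fun y => Prod.ext ((hEW _).mpr rfl) rfl
  have hEL : ∀ x y, E.linear (x, y) = (L₀ x, M₀ x + N₀ y) := by
    intro x y
    have h2 : (x, y) = (x, 0) + (0, y) := by simp
    rw [h2, _root_.map_add, hEN]
    refine Prod.ext ?_ rfl
    change L₀ x + 0 = L₀ x
    rw [add_zero]
  have hL : Function.Injective L₀ := by
    rw [← LinearMap.ker_eq_bot, LinearMap.ker_eq_bot']
    intro x hx
    exact (hEW (x, 0)).mp hx
  have hN : Function.Injective N₀ := by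
    rw [← LinearMap.ker_eq_bot, LinearMap.ker_eq_bot']
    intro y hy
    have h2 := hEN y
    rw [hy] at h2
    have h3 : ((0 : V), y) = 0 := E.linear.injective (by rw [h2, _root_.map_zero]; rfl)
    exact congrArg Prod.snd h3
  set c := (E 0).1 with hc
  have key : ∀ x, g (L₀ x + c) = M₀ x + N₀ (f x) + g c := by
    intro x
    have h2 : ∀ x, E (x, f x) = (L₀ x, M₀ x + N₀ (f x)) + E 0 := by
      intro x
      rw [← hEL]
      have := E.apply_eq_linear_add (x, f x) 0
      rwa [sub_zero] at this
    have h3 : E 0 = (c, g c) := by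
      obtain ⟨z, hz⟩ := hE 0
      rw [hf.map_zero] at hz
      change E 0 = _ at hz
      have : c = z := by rw [hc, hz]
      rw [this, hz]
    obtain ⟨z, hz⟩ := hE x
    rw [h2, h3] at hz
    have hz1 : L₀ x + c = z := congrArg Prod.fst hz
    have hz2 : M₀ x + N₀ (f x) + g c = g z := congrArg Prod.snd hz
    rw [hz1, hz2]
  refine ⟨LinearEquiv.ofInjectiveEndo L₀ hL, LinearEquiv.ofInjectiveEndo N₀ hN, fun x a => ?_⟩
  change B' (L₀ x) (L₀ a) = N₀ (B x a)
  have e1 := key (x + a)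
  have e2 := key x
  have e3 := key a
  have e4 : L₀ (x + a) + c = L₀ x + c + L₀ a := by
    rw [_root_.map_add]
    abel
  rw [e4, hg.map_add, e2, hf.map_add, _root_.map_add, _root_.map_add, _root_.map_add,
    _root_.map_add, LinearMap.add_apply] at e1
  rw [add_comm, hg.map_add] at e3
  rw [← sub_eq_zero] at e1 e3 ⊢
  rw [← sub_zero (0 : V)]
  nth_rewrite 1 [← e1]
  rw [← e3]
  abel

end IsQuadraticAPN

/-! ### Linearized polynomials over finite fields of characteristic two -/

section
variable (F : Type*) [Field F] [CharP F 2] {m : ℕ}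

/-- The iterated Frobenius `x ↦ x ^ 2 ^ i`. For `|F| = 2 ^ m` the exponent matters only modulo `m`,
and `i : ZMod m` enters through its representative in `[0, m)`. -/
def twist (i : ZMod m) : F →+* F := iterateFrobenius F 2 i.val
variable {F}

theorem twist_apply (i : ZMod m) (x : F) : twist F i x = x ^ 2 ^ i.val :=
  iterateFrobenius_def 2 i.val x

theorem twist_natCast [Finite F] (hF : Nat.card F = 2 ^ m) (n : ℕ) (x : F) :
    twist F (n : ZMod m) x = x ^ 2 ^ n := by
  have hm : ∀ x : F, x ^ 2 ^ m = x := fun x => by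
    have := Fintype.ofFinite F
    rw [← hF, Nat.card_eq_fintype_card, FiniteField.pow_card]
  have hq : ∀ q : ℕ, ∀ x : F, x ^ 2 ^ (m * q) = x := by
    intro q
    induction q with
    | zero => simp
    | succ q ih =>
      intro x
      rw [Nat.mul_succ, pow_add, pow_mul, ih, hm]
  rw [twist_apply, ZMod.val_natCast]
  conv_rhs => rw [← Nat.mod_add_div n m, pow_add, pow_mul, hq]

variable [NeZero m]

theorem twist_add [Finite F] (hF : Nat.card F = 2 ^ m) (i j : ZMod m) (x : F) :
    twist F (i + j) x = twist F i (twist F j x) := by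
  have h : i + j = ((j.val + i.val : ℕ) : ZMod m) := by
    push_cast
    rw [ZMod.natCast_zmod_val, ZMod.natCast_zmod_val, add_comm]
  rw [h, twist_natCast hF, twist_apply, twist_apply, pow_add, pow_mul]

/-- The maps `x ↦ x ^ 2 ^ i` are told apart by a generator of the multiplicative group. -/
theorem twist_injective [Finite F] (hF : Nat.card F = 2 ^ m) (hm : 2 ≤ m) :
    Function.Injective fun i : ZMod m => (twist F i : F →* F) := by
  intro i j hij
  have := Fintype.ofFinite F
  obtain ⟨g, hg⟩ := IsCyclic.exists_generator (α := Fˣ)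
  have ho : orderOf g = 2 ^ m - 1 := by
    rw [orderOf_eq_card_of_forall_mem_zpowers hg, Nat.card_units, hF]
  have hlt : ∀ i : ZMod m, 2 ^ i.val < orderOf g := by
    intro i
    rw [ho]
    have h1 : 2 ^ i.val ≤ 2 ^ (m - 1) := Nat.pow_le_pow_right (by norm_num) (by
      have := ZMod.val_lt i
      omega)
    have h2 : 2 ^ m = 2 * 2 ^ (m - 1) := by
      rw [← pow_succ']
      congr 1
      omega
    have h3 : 2 ^ 1 ≤ 2 ^ (m - 1) := Nat.pow_le_pow_right (by norm_num) (by omega)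
    omega
  have h1 : twist F i (g : F) = twist F j (g : F) := DFunLike.congr_fun hij (g : F)
  rw [twist_apply, twist_apply, ← Units.val_pow_eq_pow_val, ← Units.val_pow_eq_pow_val,
    Units.val_inj] at h1
  exact ZMod.val_injective m (Nat.pow_right_injective le_rfl
    (pow_injOn_Iio_orderOf (hlt i) (hlt j) h1))

theorem eq_zero_of_sum_twist [Finite F] (hF : Nat.card F = 2 ^ m) (hm : 2 ≤ m) {a : ZMod m → F}
    (h : ∀ x, ∑ i, a i * twist F i x = 0) : a = 0 := by
  have h1 := (linearIndependent_monoidHom F F).comp _ (twist_injective hF hm)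
  rw [Fintype.linearIndependent_iff] at h1
  funext i
  refine h1 a ?_ i
  funext x
  rw [Finset.sum_apply]
  exact h x

/-- The function `φ` is given by the linearized polynomial `∑ i, a i * x ^ 2 ^ i`. -/
def HasCoeff (φ : F → F) (a : ZMod m → F) : Prop := ∀ x, φ x = ∑ i, a i * twist F i x

/-- The function `Φ` is given by the bilinearized polynomial `∑ i j, M i j * x ^ 2 ^ i * u ^ 2 ^ j`.
-/
def HasCoeff₂ (Φ : F → F → F) (M : ZMod m → ZMod m → F) : Prop :=
  ∀ x u, Φ x u = ∑ i, ∑ j, M i j * (twist F i x * twist F j u)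

theorem HasCoeff₂.unique [Finite F] (hF : Nat.card F = 2 ^ m) (hm : 2 ≤ m) {Φ : F → F → F}
    {M M' : ZMod m → ZMod m → F} (h : HasCoeff₂ Φ M) (h' : HasCoeff₂ Φ M') (i j : ZMod m) :
    M i j = M' i j := by
  have h1 : ∀ u, (fun i => ∑ j, (M i j - M' i j) * twist F j u) = 0 := by
    intro u
    refine eq_zero_of_sum_twist hF hm fun x => ?_
    have h2 := (h x u).symm.trans (h' x u)
    rw [← sub_eq_zero, ← Finset.sum_sub_distrib] at h2
    rw [← h2]
    refine Finset.sum_congr rfl fun i _ => ?_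
    rw [Finset.sum_mul, ← Finset.sum_sub_distrib]
    refine Finset.sum_congr rfl fun j _ => ?_
    ring
  have h2 := eq_zero_of_sum_twist hF hm (a := fun j => M i j - M' i j) fun u => congrFun (h1 u) i
  exact sub_eq_zero.mp (congrFun h2 j)

/-- The `m` powers of Frobenius are linearly independent over `F`, and the space of additive maps
`F → F` has dimension `m` over `F`. -/
theorem exists_hasCoeff [Finite F] [Algebra (ZMod 2) F] (hF : Nat.card F = 2 ^ m) (hm : 2 ≤ m)
    (φ : F →ₗ[ZMod 2] F) : ∃ a : ZMod m → F, HasCoeff φ a := by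
  let E : ZMod m → (F →ₗ[ZMod 2] F) := fun i => (twist F i).toAddMonoidHom.toZModLinearMap 2
  have hE : ∀ i x, E i x = twist F i x := fun _ _ => rfl
  have hfin : finrank (ZMod 2) F = m := by
    have h1 := Module.natCard_eq_pow_finrank (K := ZMod 2) (V := F)
    rw [hF, Nat.card_zmod] at h1
    exact (Nat.pow_right_injective le_rfl h1).symm
  have hli : LinearIndependent F E := by
    rw [Fintype.linearIndependent_iff]
    intro a ha i
    refine congrFun (eq_zero_of_sum_twist hF hm fun x => ?_) i
    have := LinearMap.congr_fun ha x
    simpa [hE] using this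
  have hspan := hli.span_eq_top_of_card_eq_finrank' (by
    rw [Module.finrank_linearMap_self, hfin, ZMod.card])
  have hφ : φ ∈ Submodule.span F (Set.range E) := hspan ▸ Submodule.mem_top
  obtain ⟨a, ha⟩ := (Submodule.mem_span_range_iff_exists_fun F).mp hφ
  refine ⟨a, fun x => ?_⟩
  rw [← ha]
  simp [hE]

theorem HasCoeff.pow [Finite F] (hF : Nat.card F = 2 ^ m) {φ : F → F} {a : ZMod m → F}
    (h : HasCoeff φ a) (k : ℕ) :
    HasCoeff (fun x => φ x ^ 2 ^ k) (fun i : ZMod m => a (i - (k : ZMod m)) ^ 2 ^ k) := by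
  intro x
  change φ x ^ 2 ^ k = _
  rw [h x, ← iterateFrobenius_def (R := F), map_sum, ← Equiv.sum_comp (Equiv.subRight (k : ZMod m))]
  refine Finset.sum_congr rfl fun i _ => ?_
  rw [Equiv.subRight_apply, map_mul, iterateFrobenius_def, iterateFrobenius_def,
    ← twist_natCast hF k (twist F _ x), ← twist_add hF, add_sub_cancel]

theorem HasCoeff₂.pow [Finite F] (hF : Nat.card F = 2 ^ m) {Φ : F → F → F}
    {M : ZMod m → ZMod m → F} (h : HasCoeff₂ Φ M) (s : ℕ) :
    HasCoeff₂ (fun x u => Φ x u ^ 2 ^ s)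
      (fun i j : ZMod m => M (i - (s : ZMod m)) (j - (s : ZMod m)) ^ 2 ^ s) := by
  intro x u
  change Φ x u ^ 2 ^ s = _
  rw [h x u, ← iterateFrobenius_def (R := F), map_sum,
    ← Equiv.sum_comp (Equiv.subRight (s : ZMod m))]
  refine Finset.sum_congr rfl fun i _ => ?_
  rw [map_sum, ← Equiv.sum_comp (Equiv.subRight (s : ZMod m))]
  refine Finset.sum_congr rfl fun j _ => ?_
  rw [Equiv.subRight_apply, Equiv.subRight_apply, map_mul, map_mul, iterateFrobenius_def,
    iterateFrobenius_def, iterateFrobenius_def, ← twist_natCast hF s (twist F _ x),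
    ← twist_natCast hF s (twist F _ u), ← twist_add hF, ← twist_add hF, add_sub_cancel,
    add_sub_cancel]

theorem HasCoeff.mul {φ ψ : F → F} {a b : ZMod m → F} (h : HasCoeff φ a) (h' : HasCoeff ψ b) :
    HasCoeff₂ (fun x u => φ x * ψ u) (fun i j => a i * b j) := by
  intro x u
  change φ x * ψ u = _
  rw [h x, h' u, Finset.sum_mul_sum]
  refine Finset.sum_congr rfl fun i _ => Finset.sum_congr rfl fun j _ => ?_
  ring

theorem HasCoeff₂.add {Φ Ψ : F → F → F} {M N : ZMod m → ZMod m → F} (h : HasCoeff₂ Φ M)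
    (h' : HasCoeff₂ Ψ N) : HasCoeff₂ (fun x u => Φ x u + Ψ x u) (fun i j => M i j + N i j) := by
  intro x u
  change Φ x u + Ψ x u = _
  rw [h x u, h' x u, ← Finset.sum_add_distrib]
  refine Finset.sum_congr rfl fun i _ => ?_
  rw [← Finset.sum_add_distrib]
  refine Finset.sum_congr rfl fun j _ => ?_
  ring

theorem HasCoeff₂.const_mul {Φ : F → F → F} {M : ZMod m → ZMod m → F} (h : HasCoeff₂ Φ M)
    (c : F) : HasCoeff₂ (fun x u => c * Φ x u) (fun i j => c * M i j) := by
  intro x u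
  change c * Φ x u = _
  rw [h x u, Finset.mul_sum]
  refine Finset.sum_congr rfl fun i _ => ?_
  rw [Finset.mul_sum]
  refine Finset.sum_congr rfl fun j _ => ?_
  ring

theorem HasCoeff.comp_mul {φ : F → F} {n : ZMod m → F} (h : HasCoeff φ n) :
    HasCoeff₂ (fun x u => φ (x * u)) (fun i j => if i = j then n i else 0) := by
  intro x u
  change φ (x * u) = _
  rw [h]
  refine Finset.sum_congr rfl fun i _ => ?_
  simp [ite_mul]

theorem HasCoeff.comp_gold [Finite F] (hF : Nat.card F = 2 ^ m) {φ : F → F} {n : ZMod m → F}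
    (h : HasCoeff φ n) (l : ℕ) :
    HasCoeff₂ (fun x u => φ (x ^ 2 ^ l * u + x * u ^ 2 ^ l)) (fun i j : ZMod m =>
      (if i = j + (l : ZMod m) then n j else 0) + (if j = i + (l : ZMod m) then n i else 0)) := by
  intro x u
  change φ (x ^ 2 ^ l * u + x * u ^ 2 ^ l) = _
  have h1 : ∀ i : ZMod m, ∀ y : F, twist F i (y ^ 2 ^ l) = twist F (i + (l : ZMod m)) y := by
    intro i y
    rw [twist_add hF, twist_natCast hF]
  rw [h]
  simp only [add_mul, ite_mul, zero_mul, Finset.sum_add_distrib]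
  rw [Finset.sum_comm (γ := ZMod m)]
  simp only [Finset.sum_ite_eq', Finset.mem_univ, if_true]
  rw [← Finset.sum_add_distrib]
  refine Finset.sum_congr rfl fun i _ => ?_
  rw [map_add, map_mul, map_mul, h1, h1]
  ring

theorem HasCoeff.comp_mul_pow [Finite F] (hF : Nat.card F = 2 ^ m) {φ : F → F} {n : ZMod m → F}
    (h : HasCoeff φ n) (β : F) (t : ℕ) :
    HasCoeff (fun z => φ (β * z ^ 2 ^ t))
      (fun i : ZMod m => n (i - (t : ZMod m)) * twist F (i - (t : ZMod m)) β) := by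
  intro x
  change φ (β * x ^ 2 ^ t) = _
  rw [h, ← Equiv.sum_comp (Equiv.subRight (t : ZMod m))]
  refine Finset.sum_congr rfl fun i _ => ?_
  rw [Equiv.subRight_apply, map_mul, ← twist_natCast hF t x, ← twist_add hF, sub_add_cancel]
  ring

end

/-! ### Coefficients of an equivalence between Pott-Zhou forms -/

section
variable {F : Type*} [Field F] {m : ℕ}

/-- The left sides of `fst_left` and `fst_right` at the pair `(j + k, j)` for coefficients sitting
at a single index. -/
theorem gold_coeff_of_support_single {a c : ZMod m → F} {k s : ℕ} {i : ZMod m}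
    (hk : (k : ZMod m) + k ≠ 0) (ha : ∀ j, j ≠ i → a j = 0) (hc : ∀ j, j ≠ i → c j = 0) (α : F)
    (j : ZMod m) :
    a (j + (k : ZMod m) - (k : ZMod m)) ^ 2 ^ k * a j +
      a (j + (k : ZMod m)) * a (j - (k : ZMod m)) ^ 2 ^ k +
    α * (c (j + (k : ZMod m) - (s : ZMod m) - (k : ZMod m)) ^ 2 ^ k * c (j - (s : ZMod m)) +
      c (j + (k : ZMod m) - (s : ZMod m)) * c (j - (s : ZMod m) - (k : ZMod m)) ^ 2 ^ k) ^ 2 ^ s =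
    (if j = i then a i ^ 2 ^ k * a i else 0) +
      (if j = i + (s : ZMod m) then α * (c i ^ 2 ^ k * c i) ^ 2 ^ s else 0) := by
  have h0 : ∀ e : ZMod m → F, (∀ j, j ≠ i → e j = 0) → ∀ r : ZMod m,
      e (r + k) * e (r - k) ^ 2 ^ k = 0 := by
    intro e he r
    by_cases hr : r + k = i
    · rw [he (r - k) (fun h => hk (by linear_combination hr - h)), zero_pow (by positivity),
        mul_zero]
    · rw [he _ hr, zero_mul]
  have h1 : j + (k : ZMod m) - s = j - s + k := by ring
  rw [h1, h0 a ha, h0 c hc, add_sub_cancel_right, add_sub_cancel_right, add_zero, add_zero]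
  congr 1
  · split_ifs with h
    · rw [h]
    · rw [ha j h, mul_zero]
  · split_ifs with h
    · rw [h, add_sub_cancel_right]
    · rw [hc (j - s) (fun e => h (by rw [← e, sub_add_cancel])), mul_zero, zero_pow (by positivity),
        mul_zero]

end

section
variable {F : Type*} [Field F] [CharP F 2] {m : ℕ}

theorem det_eq_zero_of_det_eq_zero {x₁ x₂ y₁ y₂ u₁ u₂ : F} (hu : u₁ ≠ 0 ∨ u₂ ≠ 0)
    (hx : x₁ * u₂ + x₂ * u₁ = 0) (hy : y₁ * u₂ + y₂ * u₁ = 0) : x₁ * y₂ + x₂ * y₁ = 0 := by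
  have h2 : (2 : F) = 0 := CharTwo.two_eq_zero
  rcases hu with hu | hu
  · refine (mul_eq_zero.mp ?_).resolve_right hu
    linear_combination x₁ * hy + y₁ * hx - x₁ * y₁ * u₂ * h2
  · refine (mul_eq_zero.mp ?_).resolve_right hu
    linear_combination x₂ * hy + y₂ * hx - x₂ * y₂ * u₁ * h2

theorem eq_zero_of_det_eq_zero {x₁ x₂ u₁ u₂ v₁ v₂ : F} (huv : u₁ * v₂ + u₂ * v₁ ≠ 0)
    (hu : x₁ * u₂ + x₂ * u₁ = 0) (hv : x₁ * v₂ + x₂ * v₁ = 0) : x₁ = 0 ∧ x₂ = 0 := by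
  have h2 : (2 : F) = 0 := CharTwo.two_eq_zero
  constructor
  · refine (mul_eq_zero.mp ?_).resolve_right huv
    linear_combination u₁ * hv + v₁ * hu - u₁ * x₂ * v₁ * h2
  · refine (mul_eq_zero.mp ?_).resolve_right huv
    linear_combination u₂ * hv + v₂ * hu - u₂ * x₁ * v₂ * h2

/-- The relations obtained by comparing coefficients in `B_{k,s,α} (L p) (L q) = N (B_{l,t,β} p q)`,
where
`L (x, y) = (∑ i, a i x ^ 2 ^ i + ∑ i, b i y ^ 2 ^ i, ∑ i, c i x ^ 2 ^ i + ∑ i, d i y ^ 2 ^ i)` and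
`N` has coefficients `ν` (first to first component), `n` (first to second component) and `n'`
(second to second component). The prefix `fst` or `snd` of a field names the component compared; the
suffix says whether both arguments are taken in `F × 0`, both in `0 × F`, or one in each. The last
three fields record the bijectivity of `L`. The proofs view `(a i, c i)` and `(b i, d i)` as vectors
in the plane, whose pairwise determinants are governed by the `snd` relations. -/
structure CoeffRelations (k s l t : ℕ) (α β : F) (a b c d n n' ν : ZMod m → F) : Prop where
  snd_left : ∀ i j, a i * c j + c i * a j =
    (if i = j + (l : ZMod m) then n j else 0) + (if j = i + (l : ZMod m) then n i else 0)
  snd_right : ∀ i j, b i * d j + d i * b j =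
    (if i = j + (l : ZMod m) then n (j - (t : ZMod m)) * twist F (j - (t : ZMod m)) β else 0) +
    (if j = i + (l : ZMod m) then n (i - (t : ZMod m)) * twist F (i - (t : ZMod m)) β else 0)
  snd_mixed : ∀ i j, a i * d j + c i * b j = if i = j then n' i else 0
  fst_left : ∀ i j, a (i - (k : ZMod m)) ^ 2 ^ k * a j + a i * a (j - (k : ZMod m)) ^ 2 ^ k +
    α * (c (i - (s : ZMod m) - (k : ZMod m)) ^ 2 ^ k * c (j - (s : ZMod m)) +
      c (i - (s : ZMod m)) * c (j - (s : ZMod m) - (k : ZMod m)) ^ 2 ^ k) ^ 2 ^ s =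
    (if i = j + (l : ZMod m) then ν j else 0) + (if j = i + (l : ZMod m) then ν i else 0)
  fst_right : ∀ i j, b (i - (k : ZMod m)) ^ 2 ^ k * b j + b i * b (j - (k : ZMod m)) ^ 2 ^ k +
    α * (d (i - (s : ZMod m) - (k : ZMod m)) ^ 2 ^ k * d (j - (s : ZMod m)) +
      d (i - (s : ZMod m)) * d (j - (s : ZMod m) - (k : ZMod m)) ^ 2 ^ k) ^ 2 ^ s =
    (if i = j + (l : ZMod m) then ν (j - (t : ZMod m)) * twist F (j - (t : ZMod m)) β else 0) +
    (if j = i + (l : ZMod m) then ν (i - (t : ZMod m)) * twist F (i - (t : ZMod m)) β else 0)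
  left_ne : ∃ i, a i ≠ 0 ∨ c i ≠ 0
  right_ne : ∃ i, b i ≠ 0 ∨ d i ≠ 0
  not_proportional : ∀ p q, (∀ i, p * a i + q * c i = 0) → (∀ i, p * b i + q * d i = 0) →
    p = 0 ∧ q = 0

namespace CoeffRelations
variable {k s l t : ℕ} {α β : F} {a b c d n n' ν : ZMod m → F}

/-- Otherwise all the vectors `(a i, c i)` and `(b i, d i)` are proportional, and the image of `L`
lies in a line. -/
theorem exists_det_ne_zero (h : CoeffRelations k s l t α β a b c d n n' ν) :
    ∃ i, a i * d i + c i * b i ≠ 0 := by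
  by_contra! h0
  have h1 : ∀ i j, a i * d j + c i * b j = 0 := by
    intro i j
    by_cases hij : i = j
    · rw [← hij, h0]
    · rw [h.snd_mixed, if_neg hij]
  obtain ⟨i, hi⟩ := h.left_ne
  obtain ⟨j, hj⟩ := h.right_ne
  have h2 := h.not_proportional (c i) (a i)
    (fun r => by
      rw [add_comm]
      exact det_eq_zero_of_det_eq_zero hj (h1 i j) (h1 r j))
    (fun r => by rw [add_comm, h1])
  exact hi.elim (fun h => h h2.2) (fun h => h h2.1)

theorem support_left (h : CoeffRelations k s l t α β a b c d n n' ν) {i j : ZMod m}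
    (hi : a i * d i + c i * b i ≠ 0) (hij : j ≠ i) (h1 : i ≠ j + l) (h2 : j ≠ i + l) :
    a j = 0 ∧ c j = 0 :=
  eq_zero_of_det_eq_zero hi
    (by rw [h.snd_left, if_neg h2, if_neg h1, add_zero])
    (by rw [h.snd_mixed, if_neg hij])

theorem coeff_eq_zero_left (h : CoeffRelations k s l t α β a b c d n n' ν)
    (hl : (l : ZMod m) + l ≠ 0) {i j : ZMod m} (hi : a i * d i + c i * b i ≠ 0)
    (h1 : j ≠ i) (h2 : j + l ≠ i) : n j = 0 := by
  have h3 := h.snd_left (j + l) j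
  rw [if_pos rfl, if_neg (by rwa [add_assoc, left_eq_add]), add_zero] at h3
  rw [← h3]
  refine det_eq_zero_of_det_eq_zero (u₁ := b i) (u₂ := d i) ?_ ?_ ?_
  · by_contra! h0
    rw [h0.1, h0.2, mul_zero, mul_zero, add_zero] at hi
    exact hi rfl
  · rw [h.snd_mixed, if_neg h2]
  · rw [h.snd_mixed, if_neg h1]

theorem coeff_eq_zero_right (h : CoeffRelations k s l t α β a b c d n n' ν) (hβ : β ≠ 0)
    (hl : (l : ZMod m) + l ≠ 0) {i j : ZMod m} (hi : a i * d i + c i * b i ≠ 0)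
    (h1 : j + t ≠ i) (h2 : j + t + l ≠ i) : n j = 0 := by
  have h3 := h.snd_right (j + t + l) (j + t)
  rw [if_pos rfl, if_neg (by rwa [add_assoc _ (l : ZMod m), left_eq_add]), add_zero,
    add_sub_cancel_right] at h3
  refine (mul_eq_zero.mp (h3.symm.trans ?_)).resolve_right ((map_ne_zero _).mpr hβ)
  refine det_eq_zero_of_det_eq_zero (u₁ := a i) (u₂ := c i) ?_ ?_ ?_
  · by_contra! h0
    rw [h0.1, h0.2, zero_mul, zero_mul, add_zero] at hi
    exact hi rfl
  · have := h.snd_mixed i (j + t + l)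
    rw [if_neg h2.symm] at this
    linear_combination this
  · have := h.snd_mixed i (j + t)
    rw [if_neg h1.symm] at this
    linear_combination this

theorem coeff_eq_zero (h : CoeffRelations k s l t α β a b c d n n' ν) (hβ : β ≠ 0)
    (hl : (l : ZMod m) + l ≠ 0) (ht : (t : ZMod m) ≠ 0) (htl : (t : ZMod m) ≠ l)
    (htl' : (t : ZMod m) + l ≠ 0) {i : ZMod m} (hi : a i * d i + c i * b i ≠ 0) (j : ZMod m) :
    n j = 0 := by
  by_contra hj
  have h1 : j = i ∨ j + l = i := by
    by_contra! h1
    exact hj (h.coeff_eq_zero_left hl hi h1.1 h1.2)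
  have h2 : j + t = i ∨ j + t + l = i := by
    by_contra! h2
    exact hj (h.coeff_eq_zero_right hβ hl hi h2.1 h2.2)
  rcases h1 with h1 | h1 <;> rcases h2 with h2 | h2
  · exact ht (by linear_combination h2 - h1)
  · exact htl' (by linear_combination h2 - h1)
  · exact htl (by linear_combination h2 - h1)
  · exact ht (by linear_combination h2 - h1)

/-- For `t ≠ 0` all coefficients sit at a single index `i`, so `L` is semilinear over `F`. For a
non-zero `n j` the pair `j`, `j + l` has to contain `i` by `snd_left`, and the pair `j + t`,
`j + t + l` has to contain `i` by `snd_right`; this is impossible, so `n` vanishes. -/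
theorem support_single (h : CoeffRelations k s l t α β a b c d n n' ν) (hβ : β ≠ 0)
    (hl : (l : ZMod m) + l ≠ 0) (ht : (t : ZMod m) ≠ 0) (htl : (t : ZMod m) ≠ l)
    (htl' : (t : ZMod m) + l ≠ 0) {i : ZMod m} (hi : a i * d i + c i * b i ≠ 0) {j : ZMod m}
    (hj : j ≠ i) : (a j = 0 ∧ c j = 0) ∧ b j = 0 ∧ d j = 0 := by
  have hn := h.coeff_eq_zero hβ hl ht htl htl' hi
  constructor
  · refine eq_zero_of_det_eq_zero hi ?_ ?_
    · rw [h.snd_left, hn, hn, ite_self, ite_self, add_zero]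
    · rw [h.snd_mixed, if_neg hj]
  · refine eq_zero_of_det_eq_zero hi ?_ ?_
    · have := h.snd_mixed i j
      rw [if_neg hj.symm] at this
      linear_combination this
    · rw [h.snd_right, hn, hn, zero_mul, zero_mul, ite_self, ite_self, add_zero]

/-- If `s = 0` and `k ≠ ± l` modulo `m`, the coefficient of `fst_left` at `(i + k, i)` is non-zero,
where the right side is zero. This needs only that the support is contained in `{i, i + l, i - l}`.
-/
theorem eq_or_add_eq_zero_of_shift_eq_zero (h : CoeffRelations k 0 l t α β a b c d n n' ν)
    (hα : ∀ x y : F, x ^ 2 ^ k * x + α * (y ^ 2 ^ k * y) ^ 2 ^ 0 = 0 → x = 0 ∧ y = 0)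
    (hk : (k : ZMod m) ≠ 0) : (k : ZMod m) = l ∨ (k : ZMod m) + l = 0 := by
  by_contra! hkl
  obtain ⟨i, hi⟩ := h.exists_det_ne_zero
  have h1 := h.support_left (j := i + k) hi (by simpa using hk)
    (fun e => hkl.2 (by linear_combination -e)) (fun e => hkl.1 (by linear_combination e))
  have h2 := h.fst_left (i + k) i
  rw [if_neg (fun e => hkl.1 (by linear_combination e)),
    if_neg (fun e => hkl.2 (by linear_combination -e))] at h2
  simp only [Nat.cast_zero, sub_zero, add_sub_cancel_right, h1.1, h1.2, zero_mul, add_zero] at h2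
  have h3 := hα _ _ h2
  rw [h3.1, h3.2, zero_mul, zero_mul, add_zero] at hi
  exact hi rfl

/-- For coefficients sitting at a single index `i`, a coefficient of `fst_left` at `(i + k, i)` or
at `(i + s + k, i + s)` is non-zero, so that `k = ± l` modulo `m`. -/
theorem eq_or_add_eq_zero (h : CoeffRelations k s l t α β a b c d n n' ν)
    (hα : ∀ x y : F, x ^ 2 ^ k * x + α * (y ^ 2 ^ k * y) ^ 2 ^ s = 0 → x = 0 ∧ y = 0)
    (hk : (k : ZMod m) + k ≠ 0) {i : ZMod m} (hi : a i * d i + c i * b i ≠ 0)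
    (hsupp : ∀ j, j ≠ i → a j = 0 ∧ c j = 0) :
    (k : ZMod m) = l ∨ (k : ZMod m) + l = 0 := by
  by_contra! hkl
  have h1 : ∀ j, (if j = i then a i ^ 2 ^ k * a i else 0) +
      (if j = i + (s : ZMod m) then α * (c i ^ 2 ^ k * c i) ^ 2 ^ s else 0) = 0 := by
    intro j
    rw [← gold_coeff_of_support_single hk (fun j hj => (hsupp j hj).1)
      (fun j hj => (hsupp j hj).2), h.fst_left,
      if_neg (fun e => hkl.1 (by linear_combination e)),
      if_neg (fun e => hkl.2 (by linear_combination -e)), add_zero]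
  have h2 : a i ^ 2 ^ k * a i + α * (c i ^ 2 ^ k * c i) ^ 2 ^ s = 0 := by
    have e1 := h1 i
    have e2 := h1 (i + s)
    rw [if_pos rfl] at e1 e2
    by_cases hs : i = i + s
    · rwa [if_pos hs] at e1
    · rw [if_neg hs, add_zero] at e1
      rw [if_neg (Ne.symm hs), zero_add] at e2
      rw [e1, e2, add_zero]
  have h3 := hα _ _ h2
  rw [h3.1, h3.2, zero_mul, zero_mul, add_zero] at hi
  exact hi rfl

/-- By `fst_left`, `ν` is non-zero at `i` if `a i ≠ 0` or `s = 0`, and at `i + s` if `c i ≠ 0`; by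
`fst_right`, `ν` is supported on `{i - t, i + s - t}`. -/
theorem shift_eq_or_add_eq_zero (h : CoeffRelations k s k t α β a b c d n n' ν)
    (hα : ∀ x y : F, x ^ 2 ^ k * x + α * (y ^ 2 ^ k * y) ^ 2 ^ s = 0 → x = 0 ∧ y = 0)
    (hα0 : α ≠ 0) (hβ : β ≠ 0)
    (hk : (k : ZMod m) + k ≠ 0) (ht : (t : ZMod m) ≠ 0) {i : ZMod m}
    (hi : a i * d i + c i * b i ≠ 0)
    (hsupp : ∀ j, j ≠ i → (a j = 0 ∧ c j = 0) ∧ b j = 0 ∧ d j = 0) :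
    (s : ZMod m) = t ∨ (s : ZMod m) + t = 0 := by
  have hneg : ∀ j : ZMod m, j ≠ j + k + k := fun j e => hk (by linear_combination -e)
  have hx : ∀ j, ν j = (if j = i then a i ^ 2 ^ k * a i else 0) +
      (if j = i + (s : ZMod m) then α * (c i ^ 2 ^ k * c i) ^ 2 ^ s else 0) := by
    intro j
    rw [← gold_coeff_of_support_single hk (fun j hj => (hsupp j hj).1.1)
      (fun j hj => (hsupp j hj).1.2), h.fst_left, if_pos rfl, if_neg (hneg j), add_zero]
  have hy : ∀ j, ν j * twist F j β = (if j + t = i then b i ^ 2 ^ k * b i else 0) +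
      (if j + t = i + (s : ZMod m) then α * (d i ^ 2 ^ k * d i) ^ 2 ^ s else 0) := by
    intro j
    rw [← gold_coeff_of_support_single hk (fun j hj => (hsupp j hj).2.1)
      (fun j hj => (hsupp j hj).2.2), h.fst_right, if_pos rfl, if_neg (hneg _), add_zero,
      add_sub_cancel_right]
  have hν : ∀ j, ν j ≠ 0 → j + t = i ∨ j + t = i + s := by
    intro j hj
    by_contra! hne
    have h1 := hy j
    rw [if_neg hne.1, if_neg hne.2, add_zero] at h1
    exact (mul_ne_zero hj ((map_ne_zero _).mpr hβ)) h1
  have hit : i + (t : ZMod m) ≠ i := by simpa using ht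
  by_cases hs : (s : ZMod m) = 0
  · have h1 : ν i ≠ 0 := by
      rw [hx, if_pos rfl, if_pos (by rw [hs, add_zero])]
      intro h0
      have h3 := hα _ _ h0
      rw [h3.1, h3.2, zero_mul, zero_mul, add_zero] at hi
      exact hi rfl
    rcases hν i h1 with h2 | h2
    · exact absurd h2 hit
    · exact absurd (by rw [h2, hs, add_zero]) hit
  · by_cases ha : a i = 0
    · right
      have hc : c i ≠ 0 := by
        intro hc
        rw [ha, hc, zero_mul, zero_mul, add_zero] at hi
        exact hi rfl
      have h1 : ν (i + s) ≠ 0 := by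
        rw [hx, if_pos rfl, if_neg (by simpa using hs), zero_add]
        exact mul_ne_zero hα0 (pow_ne_zero _ (mul_ne_zero (pow_ne_zero _ hc) hc))
      rcases hν _ h1 with h2 | h2
      · linear_combination h2
      · exact absurd (by linear_combination h2) ht
    · left
      have h1 : ν i ≠ 0 := by
        rw [hx, if_pos rfl, if_neg (by simpa using hs), add_zero]
        exact mul_ne_zero (pow_ne_zero _ ha) ha
      rcases hν _ h1 with h2 | h2
      · exact absurd h2 hit
      · linear_combination -h2

end CoeffRelations
end

/-! ### The polar forms of the Pott-Zhou functions -/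

theorem ZMod.natCast_add_natCast_ne_zero {m k l : ℕ} (hk : 0 < k) (hkm : k < m / 2)
    (hlm : l < m / 2) : (k : ZMod m) + l ≠ 0 := by
  rw [← Nat.cast_add, Ne, ZMod.natCast_eq_zero_iff]
  intro h
  have := Nat.le_of_dvd (by omega) h
  omega

theorem ZMod.eq_of_natCast_eq {m k l : ℕ} (hkm : k < m) (hlm : l < m)
    (h : (k : ZMod m) = l) : k = l := by
  rw [ZMod.natCast_eq_natCast_iff] at h
  exact Nat.ModEq.eq_of_lt_of_lt h hkm hlm

theorem Nat.three_dvd_two_pow_add_one {k : ℕ} (hk : Odd k) : 3 ∣ 2 ^ k + 1 := by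
  have := hk.nat_add_dvd_pow_add_pow 2 1
  simpa using this

theorem Nat.three_dvd_two_pow_sub_one {s : ℕ} (hs : Even s) : 3 ∣ 2 ^ s - 1 := by
  obtain ⟨r, rfl⟩ := hs
  rw [← two_mul, pow_mul]
  have := Nat.sub_dvd_pow_sub_pow 4 1 r
  simpa using this

section
variable {F : Type*} [Field F]

/-- Since `3 ∣ 2 ^ k + 1` for odd `k`, a solution with `y ≠ 0` would make `α` a cube. -/
theorem eq_zero_of_noncube {k s : ℕ} {α : F} (hk : Odd k) (hα : ∀ c : F, c ^ 3 ≠ α)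
    (hF : CharP F 2) (x y : F) (h : x ^ 2 ^ k * x + α * (y ^ 2 ^ k * y) ^ 2 ^ s = 0) :
    x = 0 ∧ y = 0 := by
  obtain ⟨r, hr⟩ := Nat.three_dvd_two_pow_add_one hk
  rw [← pow_succ, ← pow_succ, hr] at h
  have hy : y = 0 := by
    by_contra hy
    refine hα (x ^ r / (y ^ r) ^ 2 ^ s) ?_
    rw [div_pow, div_eq_iff (pow_ne_zero _ (pow_ne_zero _ (pow_ne_zero _ hy)))]
    rw [CharTwo.add_eq_zero] at h
    rw [← pow_mul, mul_comm r 3, h]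
    ring
  refine ⟨?_, hy⟩
  have : r ≠ 0 := by
    rintro rfl
    simp at hr
  rw [hy, zero_pow (by omega), zero_pow (by positivity), mul_zero, add_zero] at h
  exact eq_zero_of_pow_eq_zero h

theorem eq_zero_or_one_of_pow_eq [Finite F] {m k : ℕ} (hF : Nat.card F = 2 ^ m)
    (hk : Nat.Coprime k m) {c : F} (hc : c ^ 2 ^ k = c) : c = 0 ∨ c = 1 := by
  by_cases h0 : c = 0
  · exact Or.inl h0
  right
  have := Fintype.ofFinite F
  have h1 : ∀ n : ℕ, c ^ 2 ^ n = c → orderOf c ∣ 2 ^ n - 1 := by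
    intro n hn
    rw [orderOf_dvd_iff_pow_eq_one]
    refine mul_right_cancel₀ h0 ?_
    rw [← pow_succ, Nat.sub_add_cancel Nat.one_le_two_pow, hn, one_mul]
  have h2 := Nat.dvd_gcd (h1 k hc) (h1 m (by
    rw [← hF, Nat.card_eq_fintype_card, FiniteField.pow_card]))
  rw [Nat.pow_sub_one_gcd_pow_sub_one, hk] at h2
  exact orderOf_eq_one_iff.mp (Nat.dvd_one.mp (by simpa using h2))

/-- The polar form `f (p + q) + f p + f q` of the Pott-Zhou function `f = f_{k,s,α}`. -/
def pottZhouForm [CharP F 2] [Algebra (ZMod 2) F] (k s : ℕ) (α : F) :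
    (F × F) →ₗ[ZMod 2] (F × F) →ₗ[ZMod 2] (F × F) :=
  AddMonoidHom.toZModLinearMap 2 <|
    AddMonoidHom.mk' (fun p => AddMonoidHom.toZModLinearMap 2 <| AddMonoidHom.mk'
      (fun q => (p.1 ^ 2 ^ k * q.1 + p.1 * q.1 ^ 2 ^ k +
        α * (p.2 ^ 2 ^ k * q.2 + p.2 * q.2 ^ 2 ^ k) ^ 2 ^ s, p.1 * q.2 + p.2 * q.1))
      (fun q r => by
        refine Prod.ext ?_ ?_
        · simp only [Prod.fst_add, Prod.snd_add, add_pow_char_pow, mul_add]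
          ring
        · simp only [Prod.fst_add, Prod.snd_add]
          ring))
      (fun p q => by
        refine LinearMap.ext fun r => ?_
        refine Prod.ext ?_ ?_
        · change (p + q).1 ^ 2 ^ k * r.1 + (p + q).1 * r.1 ^ 2 ^ k +
            α * ((p + q).2 ^ 2 ^ k * r.2 + (p + q).2 * r.2 ^ 2 ^ k) ^ 2 ^ s =
            (p.1 ^ 2 ^ k * r.1 + p.1 * r.1 ^ 2 ^ k +
            α * (p.2 ^ 2 ^ k * r.2 + p.2 * r.2 ^ 2 ^ k) ^ 2 ^ s) +
            (q.1 ^ 2 ^ k * r.1 + q.1 * r.1 ^ 2 ^ k +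
            α * (q.2 ^ 2 ^ k * r.2 + q.2 * r.2 ^ 2 ^ k) ^ 2 ^ s)
          simp only [Prod.fst_add, Prod.snd_add, add_pow_char_pow, add_mul]
          ring
        · change (p + q).1 * r.2 + (p + q).2 * r.1 =
            (p.1 * r.2 + p.2 * r.1) + (q.1 * r.2 + q.2 * r.1)
          simp only [Prod.fst_add, Prod.snd_add]
          ring)

variable [CharP F 2] [Algebra (ZMod 2) F]

theorem pottZhouForm_apply (k s : ℕ) (α : F) (p q : F × F) :
    pottZhouForm k s α p q = (p.1 ^ 2 ^ k * q.1 + p.1 * q.1 ^ 2 ^ k +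
        α * (p.2 ^ 2 ^ k * q.2 + p.2 * q.2 ^ 2 ^ k) ^ 2 ^ s, p.1 * q.2 + p.2 * q.1) := rfl

theorem pottZhouForm_left (k s : ℕ) (α : F) (x u : F) :
    pottZhouForm k s α (x, 0) (u, 0) = (x ^ 2 ^ k * u + x * u ^ 2 ^ k, 0) := by
  simp [pottZhouForm_apply]

theorem pottZhouForm_right (k s : ℕ) (α : F) (y v : F) :
    pottZhouForm k s α (0, y) (0, v) = (α * (y ^ 2 ^ k * v + y * v ^ 2 ^ k) ^ 2 ^ s, 0) := by
  simp [pottZhouForm_apply]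

theorem pottZhouForm_mixed (k s : ℕ) (α : F) (x v : F) :
    pottZhouForm k s α (x, 0) (0, v) = (0, x * v) := by
  simp [pottZhouForm_apply]

/-- If the polar form vanishes at `(p, q)`, its second component shows that `p = c • q` with
`c : F`, and the first one that `c ^ 2 ^ k = c`, because `α` is not a cube; as `k` is coprime to
`m`, this means that `c` is `0` or `1`. -/
theorem isQuadraticAPN_pottZhou [Finite F] {m k s : ℕ} [NeZero m] {α : F}
    (hF : Nat.card F = 2 ^ m) (hm : 2 ≤ m) (hk : Nat.Coprime k m) (hk_odd : Odd k)
    (hk_pos : 0 < k) (hk_lt : k < m / 2) (hs : Even s) (hα : ∀ c : F, c ^ 3 ≠ α) :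
    IsQuadraticAPN (pottZhou k s α) (pottZhouForm k s α) := by
  constructor
  · intro p q
    rw [pottZhouForm_apply]
    refine Prod.ext ?_ ?_
    · change (p.1 + q.1) ^ (2 ^ k + 1) + α * (p.2 + q.2) ^ ((2 ^ k + 1) * 2 ^ s) =
        (p.1 ^ (2 ^ k + 1) + α * p.2 ^ ((2 ^ k + 1) * 2 ^ s)) +
        (q.1 ^ (2 ^ k + 1) + α * q.2 ^ ((2 ^ k + 1) * 2 ^ s)) + _
      rw [pow_mul, pow_mul, pow_mul]
      simp only [pow_succ _ (2 ^ k), add_pow_char_pow, add_mul, mul_add]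
      ring
    · change (p.1 + q.1) * (p.2 + q.2) = p.1 * p.2 + q.1 * q.2 + (p.1 * q.2 + p.2 * q.1)
      ring
  · rintro ⟨x, y⟩ ⟨u, v⟩ h
    rw [pottZhouForm_apply, Prod.mk_eq_zero] at h
    obtain ⟨h1, h2⟩ := h
    by_cases huv : ((u, v) : F × F) = 0
    · exact Or.inl huv
    right
    obtain ⟨c, rfl, rfl⟩ : ∃ c, x = c * u ∧ y = c * v := by
      rw [CharTwo.add_eq_zero] at h2
      by_cases hu : u = 0
      · have hv : v ≠ 0 := fun hv => huv (by rw [hu, hv]; rfl)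
        refine ⟨y / v, ?_, ?_⟩
        · field_simp
          exact h2
        · field_simp
      · refine ⟨x / u, ?_, ?_⟩
        · field_simp
        · field_simp
          exact h2.symm
    -- If `z ≠ 0`, division by `z` makes `α * z ^ (2 ^ s - 1)` a cube, and `3 ∣ 2 ^ s - 1`.
    set z := c ^ 2 ^ k + c with hz
    have h3 : z * (u ^ 2 ^ k * u) + α * (z * (v ^ 2 ^ k * v)) ^ 2 ^ s = 0 := by
      have e : ∀ w, z * (w ^ 2 ^ k * w) = (c * w) ^ 2 ^ k * w + c * w * w ^ 2 ^ k := by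
        intro w
        rw [hz, mul_pow]
        ring
      rw [e, e]
      exact h1
    have hz0 : z = 0 := by
      by_contra hz0
      obtain ⟨r, hr⟩ := Nat.three_dvd_two_pow_sub_one hs
      have h4 : 2 ^ s = 1 + 3 * r := by
        have := Nat.one_le_two_pow (n := s)
        omega
      have h5 : u ^ 2 ^ k * u + (α * (z ^ r) ^ 3) * (v ^ 2 ^ k * v) ^ 2 ^ s = 0 := by
        refine (mul_eq_zero.mp ?_).resolve_left hz0
        rw [← h3, mul_pow z, show z ^ 2 ^ s = z * (z ^ r) ^ 3 by rw [h4]; ring]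
        ring
      have h6 := eq_zero_of_noncube hk_odd (α := α * (z ^ r) ^ 3) (fun e he => by
        refine hα (e / z ^ r) ?_
        rw [div_pow, he]
        field_simp) inferInstance u v h5
      exact huv (by rw [h6.1, h6.2]; rfl)
    rw [hz, CharTwo.add_eq_zero] at hz0
    rcases eq_zero_or_one_of_pow_eq hF hk hz0 with hc | hc
    · left
      simp [hc]
    · right
      simp [hc]
  · intro φ hφ
    have h1 : ∀ ψ : F →ₗ[ZMod 2] F, (∀ x u, ψ (x ^ 2 ^ k * u + x * u ^ 2 ^ k) = 0) → ψ = 0 := by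
      intro ψ hψ
      obtain ⟨n, hn⟩ := exists_hasCoeff hF hm ψ
      have h0 : HasCoeff₂ (fun x u => ψ (x ^ 2 ^ k * u + x * u ^ 2 ^ k))
          (fun _ _ : ZMod m => 0) := by
        intro x u
        simp [hψ]
      have hn0 : n = 0 := by
        funext j
        have h2 := (hn.comp_gold hF k).unique hF hm h0 (j + k) j
        have h3 := ZMod.natCast_add_natCast_ne_zero hk_pos hk_lt hk_lt
        rwa [if_pos rfl, if_neg (fun e => h3 (by linear_combination -e)), add_zero] at h2
      ext x
      rw [hn, hn0]
      simp
    have h2 : ∀ w, φ (0, w) = 0 := by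
      intro w
      have := hφ (1, 0) (0, w)
      rwa [pottZhouForm_mixed, one_mul] at this
    have h3 : φ.comp (LinearMap.inl (ZMod 2) F F) = 0 := by
      have e1 := h1 ((LinearMap.fst (ZMod 2) F F).comp (φ.comp (LinearMap.inl (ZMod 2) F F)))
        (fun x u => by
          have := hφ (x, 0) (u, 0)
          rw [pottZhouForm_left] at this
          exact congrArg Prod.fst this)
      have e2 := h1 ((LinearMap.snd (ZMod 2) F F).comp (φ.comp (LinearMap.inl (ZMod 2) F F)))
        (fun x u => by
          have := hφ (x, 0) (u, 0)
          rw [pottZhouForm_left] at this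
          exact congrArg Prod.snd this)
      refine LinearMap.ext fun x => Prod.ext ?_ ?_
      · exact LinearMap.congr_fun e1 x
      · exact LinearMap.congr_fun e2 x
    refine LinearMap.ext fun ⟨x, y⟩ => ?_
    have h4 : (x, y) = (x, 0) + (0, y) := by simp
    have h5 : φ (x, 0) = 0 := LinearMap.congr_fun h3 x
    rw [h4, map_add, h2, h5, add_zero]
    rfl

/-- `pottZhouForm l t β` is restricted to the subspaces `F × 0` and `0 × F`, on which it is a Gold
form, a twisted Gold form, or multiplication. -/
theorem exists_coeffRelations [Finite F] {m k s l t : ℕ} [NeZero m] {α β : F}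
    (hF : Nat.card F = 2 ^ m) (hm : 2 ≤ m) (L N : (F × F) ≃ₗ[ZMod 2] (F × F))
    (h : ∀ p q, pottZhouForm k s α (L p) (L q) = N (pottZhouForm l t β p q)) :
    ∃ a b c d n n' ν : ZMod m → F, CoeffRelations k s l t α β a b c d n n' ν := by
  let i₁ := LinearMap.inl (ZMod 2) F F
  let i₂ := LinearMap.inr (ZMod 2) F F
  let p₁ := LinearMap.fst (ZMod 2) F F
  let p₂ := LinearMap.snd (ZMod 2) F F
  let L' : (F × F) →ₗ[ZMod 2] (F × F) := L
  let N' : (F × F) →ₗ[ZMod 2] (F × F) := N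
  obtain ⟨a, ha⟩ := exists_hasCoeff hF hm (p₁ ∘ₗ L' ∘ₗ i₁)
  obtain ⟨b, hb⟩ := exists_hasCoeff hF hm (p₁ ∘ₗ L' ∘ₗ i₂)
  obtain ⟨c, hc⟩ := exists_hasCoeff hF hm (p₂ ∘ₗ L' ∘ₗ i₁)
  obtain ⟨d, hd⟩ := exists_hasCoeff hF hm (p₂ ∘ₗ L' ∘ₗ i₂)
  obtain ⟨n, hn⟩ := exists_hasCoeff hF hm (p₂ ∘ₗ N' ∘ₗ i₁)
  obtain ⟨n', hn'⟩ := exists_hasCoeff hF hm (p₂ ∘ₗ N' ∘ₗ i₂)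
  obtain ⟨ν, hν⟩ := exists_hasCoeff hF hm (p₁ ∘ₗ N' ∘ₗ i₁)
  have hx : ∀ x, L (x, 0) = (∑ i, a i * twist F i x, ∑ i, c i * twist F i x) :=
    fun x => Prod.ext (ha x) (hc x)
  have hy : ∀ y, L (0, y) = (∑ i, b i * twist F i y, ∑ i, d i * twist F i y) :=
    fun y => Prod.ext (hb y) (hd y)
  have hleft := fun x u => (h (x, 0) (u, 0)).trans (congrArg N (pottZhouForm_left l t β x u))
  have hright := fun x u => (h (0, x) (0, u)).trans (congrArg N (pottZhouForm_right l t β x u))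
  have hmixed := fun x u => (h (x, 0) (0, u)).trans (congrArg N (pottZhouForm_mixed l t β x u))
  refine ⟨a, b, c, d, n, n', ν, ?_, ?_, ?_, ?_, ?_, ?_, ?_, ?_⟩
  · refine HasCoeff₂.unique hF hm ((ha.mul hc).add (hc.mul ha)) ?_
    have e := hn.comp_gold hF l
    intro x u
    rw [← e x u]
    exact congrArg Prod.snd (hleft x u)
  · refine HasCoeff₂.unique hF hm ((hb.mul hd).add (hd.mul hb)) ?_
    have e := (hn.comp_mul_pow hF β t).comp_gold hF l
    intro x u
    rw [← e x u]
    exact congrArg Prod.snd (hright x u)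
  · refine HasCoeff₂.unique hF hm ((ha.mul hd).add (hc.mul hb)) ?_
    have e := hn'.comp_mul
    intro x u
    rw [← e x u]
    exact congrArg Prod.snd (hmixed x u)
  · refine HasCoeff₂.unique hF hm ((((ha.pow hF k).mul ha).add (ha.mul (ha.pow hF k))).add
      (((((hc.pow hF k).mul hc).add (hc.mul (hc.pow hF k))).pow hF s).const_mul α)) ?_
    have e := hν.comp_gold hF l
    intro x u
    rw [← e x u]
    exact congrArg Prod.fst (hleft x u)
  · refine HasCoeff₂.unique hF hm ((((hb.pow hF k).mul hb).add (hb.mul (hb.pow hF k))).add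
      (((((hd.pow hF k).mul hd).add (hd.mul (hd.pow hF k))).pow hF s).const_mul α)) ?_
    have e := (hν.comp_mul_pow hF β t).comp_gold hF l
    intro x u
    rw [← e x u]
    exact congrArg Prod.fst (hright x u)
  · by_contra! h0
    have h1 : L (1, 0) = 0 := by
      rw [hx]
      simp [h0]
    simp at h1
  · by_contra! h0
    have h1 : L (0, 1) = 0 := by
      rw [hy]
      simp [h0]
    simp at h1
  · intro p q h1 h2
    have h3 : ∀ v, p * (L v).1 + q * (L v).2 = 0 := by
      rintro ⟨x, y⟩
      have h4 : (x, y) = (x, 0) + (0, y) := by simp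
      rw [h4, map_add, hx, hy]
      simp only [Prod.fst_add, Prod.snd_add, mul_add, Finset.mul_sum]
      have e1 : ∑ i, p * (a i * twist F i x) + ∑ i, q * (c i * twist F i x) = 0 := by
        rw [← Finset.sum_add_distrib]
        refine Finset.sum_eq_zero fun i _ => ?_
        linear_combination twist F i x * h1 i
      have e2 : ∑ i, p * (b i * twist F i y) + ∑ i, q * (d i * twist F i y) = 0 := by
        rw [← Finset.sum_add_distrib]
        refine Finset.sum_eq_zero fun i _ => ?_
        linear_combination twist F i y * h2 i
      linear_combination e1 + e2
    have e1 := h3 (L.symm (1, 0))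
    have e2 := h3 (L.symm (0, 1))
    rw [L.apply_symm_apply] at e1 e2
    exact ⟨by simpa using e1, by simpa using e2⟩

end

/-! ### Equivalences between Pott-Zhou functions with equal exponents -/

section
variable {F : Type*} [Field F]

/-- This holds because `gcd (2 ^ k + 1) (2 ^ m - 1)` divides
`gcd (2 ^ (2 * k) - 1) (2 ^ m - 1) = 3`. -/
theorem exists_pow_eq_cube [Finite F] {m k : ℕ} (hF : Nat.card F = 2 ^ m) (hm : Even m)
    (hk : Nat.Coprime k m) (u : Fˣ) : ∃ w : Fˣ, w ^ (2 ^ k + 1) = u ^ 3 := by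
  have := Fintype.ofFinite F
  have h1 : Nat.gcd (2 ^ k + 1) (2 ^ m - 1) ∣ 3 := by
    have h2 : 2 ^ k + 1 ∣ 2 ^ (2 * k) - 1 := by
      refine ⟨2 ^ k - 1, ?_⟩
      have := Nat.sq_sub_sq (2 ^ k) 1
      rwa [← pow_mul, mul_comm k 2, one_pow] at this
    have h3 := Nat.gcd_dvd_gcd_of_dvd_left (2 ^ m - 1) h2
    obtain ⟨r, rfl⟩ := hm
    rw [Nat.pow_sub_one_gcd_pow_sub_one, ← two_mul, Nat.gcd_mul_left] at h3
    have h4 : Nat.gcd k r = 1 := by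
      rw [← two_mul] at hk
      exact Nat.Coprime.coprime_mul_left_right hk
    rw [h4] at h3
    rw [← two_mul]
    exact h3
  obtain ⟨e, he⟩ := h1
  have hu : u ^ (2 ^ m - 1) = 1 := by
    have := pow_card_eq_one' (x := u)
    rwa [Nat.card_units, hF] at this
  set A := Nat.gcdA (2 ^ k + 1) (2 ^ m - 1)
  set B := Nat.gcdB (2 ^ k + 1) (2 ^ m - 1)
  have hg : ((Nat.gcd (2 ^ k + 1) (2 ^ m - 1) : ℕ) : ℤ) = ((2 ^ k + 1 : ℕ) : ℤ) * A +
    ((2 ^ m - 1 : ℕ) : ℤ) * B := Nat.gcd_eq_gcd_ab _ _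
  refine ⟨u ^ (A * e), ?_⟩
  have h5 : u ^ ((Nat.gcd (2 ^ k + 1) (2 ^ m - 1) : ℕ) : ℤ) = u ^ (((2 ^ k + 1 : ℕ) : ℤ) * A) := by
    rw [hg, zpow_add, zpow_mul u ((2 ^ m - 1 : ℕ) : ℤ), zpow_natCast, hu, one_zpow, mul_one]
  rw [he, pow_mul, ← zpow_natCast u (Nat.gcd _ _), h5, ← zpow_natCast, ← zpow_natCast, ← zpow_mul,
    ← zpow_mul]
  congr 1
  ring

/-- There are two classes of non-cubes modulo cubes, and they are interchanged by squaring. -/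
theorem exists_eq_pow_mul_of_noncube [Finite F] {m k : ℕ} (hF : Nat.card F = 2 ^ m)
    (hm : Even m) (hk : Nat.Coprime k m) {α β : F} (hα : ∀ c : F, c ^ 3 ≠ α)
    (hβ : ∀ c : F, c ^ 3 ≠ β) : ∃ a ≠ 0, ∃ e : ℕ, β = a ^ (2 ^ k + 1) * α ^ 2 ^ e := by
  obtain ⟨g, hg⟩ := IsCyclic.exists_generator (α := Fˣ)
  have hlog : ∀ z : F, (∀ c : F, c ^ 3 ≠ z) → ∃ i : ℤ, ((g ^ i : Fˣ) : F) = z ∧ ¬ (3 : ℤ) ∣ i := by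
    intro z hz
    have hz0 : z ≠ 0 := fun h => hz 0 (by simp [h])
    obtain ⟨i, hi⟩ := Subgroup.mem_zpowers_iff.mp (hg (Units.mk0 z hz0))
    have hi' : ((g ^ i : Fˣ) : F) = z := by rw [hi, Units.val_mk0]
    refine ⟨i, hi', ?_⟩
    rintro ⟨q, rfl⟩
    refine hz ((g ^ q : Fˣ) : F) ?_
    rw [← hi', ← Units.val_pow_eq_pow_val, ← zpow_natCast, ← zpow_mul, mul_comm]
    rfl
  obtain ⟨i, hi, hi3⟩ := hlog α hα
  obtain ⟨j, hj, hj3⟩ := hlog β hβ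
  have hij : ∃ e : ℕ, ∃ q : ℤ, j = q * 3 + i * 2 ^ e := by
    have : (3 : ℤ) ∣ j - i ∨ (3 : ℤ) ∣ j - i * 2 := by
      have h1 : i % 3 = 1 ∨ i % 3 = 2 := by omega
      have h2 : j % 3 = 1 ∨ j % 3 = 2 := by omega
      rcases h1 with h1 | h1 <;> rcases h2 with h2 | h2 <;> omega
    rcases this with ⟨q, hq⟩ | ⟨q, hq⟩
    · exact ⟨0, q, by rw [pow_zero]; linarith⟩
    · exact ⟨1, q, by rw [pow_one]; linarith⟩
  obtain ⟨e, q, hq⟩ := hij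
  obtain ⟨w, hw⟩ := exists_pow_eq_cube hF hm hk (g ^ q)
  refine ⟨w, w.ne_zero, e, ?_⟩
  rw [← hj, ← hi, ← Units.val_pow_eq_pow_val, ← Units.val_pow_eq_pow_val, ← Units.val_mul, hw, hq,
    zpow_add, zpow_mul, zpow_mul]
  norm_cast

variable [CharP F 2] [Algebra (ZMod 2) F]

/-- The substitution `(x, y) ↦ (a * x ^ 2 ^ e, y ^ 2 ^ e)` turns `f_{k,s,β}` into `f_{k,s,α}`
followed by a linear permutation. -/
theorem ccz_pottZhou_of_eq_pow_mul [Finite F] {k s e : ℕ} {α β a : F} (ha : a ≠ 0)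
    (h : β = a ^ (2 ^ k + 1) * α ^ 2 ^ e) : CCZEquivalent (pottZhou k s α) (pottZhou k s β) := by
  let P : F → (F →ₗ[ZMod 2] F) := fun b =>
    ((AddMonoidHom.mulLeft b).comp (iterateFrobenius F 2 e).toAddMonoidHom).toZModLinearMap 2
  have hP : ∀ b x, P b x = b * x ^ 2 ^ e := fun b x => by
    change b * iterateFrobenius F 2 e x = _
    rw [iterateFrobenius_def]
  have hinj : ∀ b, b ≠ 0 → Function.Injective (P b) := by
    intro b hb
    rw [← LinearMap.ker_eq_bot, LinearMap.ker_eq_bot']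
    intro x hx
    rw [hP] at hx
    exact eq_zero_of_pow_eq_zero ((mul_eq_zero.mp hx).resolve_left hb)
  let Q : ∀ b : F, b ≠ 0 → (F ≃ₗ[ZMod 2] F) := fun b hb =>
    LinearEquiv.ofInjectiveEndo (P b) (hinj b hb)
  let L := (Q a ha).prodCongr (Q 1 one_ne_zero)
  let N := (Q (a ^ (2 ^ k + 1)) (pow_ne_zero _ ha)).prodCongr (Q a ha)
  have hLN : ∀ p, pottZhou k s β (L p) = N (pottZhou k s α p) := by
    rintro ⟨x, y⟩
    refine Prod.ext ?_ ?_
    · change (P a x) ^ (2 ^ k + 1) + β * (P 1 y) ^ ((2 ^ k + 1) * 2 ^ s) =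
        P (a ^ (2 ^ k + 1)) (x ^ (2 ^ k + 1) + α * y ^ ((2 ^ k + 1) * 2 ^ s))
      rw [hP, hP, hP, add_pow_char_pow, h]
      ring
    · change P a x * P 1 y = P a (x * y)
      rw [hP, hP, hP]
      ring
  refine ⟨(L.prodCongr N).toAffineEquiv, ?_⟩
  ext ⟨p, r⟩
  constructor
  · rintro ⟨_, ⟨v, rfl⟩, he⟩
    refine ⟨L v, ?_⟩
    rw [← he]
    exact Prod.ext rfl (hLN v)
  · rintro ⟨v, hv⟩
    refine ⟨_, ⟨L.symm v, rfl⟩, ?_⟩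
    rw [← hv]
    refine Prod.ext (L.apply_symm_apply v) ?_
    change N (pottZhou k s α (L.symm v)) = pottZhou k s β v
    rw [← hLN, L.apply_symm_apply]

/-! ### Inequivalence for different exponents -/

/-- The case `t = 0 ≠ s`, excluded by `hst`, follows from the case `t ≠ 0` on exchanging the two
functions. -/
theorem eq_of_linearEquiv [Finite F] {m k s l t : ℕ} {α β : F}
    (hm : 4 ≤ m) (hF : Nat.card F = 2 ^ m) (hk_pos : 0 < k) (hk_lt : k < m / 2) (hk : Odd k)
    (hl_pos : 0 < l) (hl_lt : l < m / 2) (hl : Odd l)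
    (hs_le : s ≤ m / 2) (ht_even : Even t) (ht_le : t ≤ m / 2)
    (hα : ∀ c : F, c ^ 3 ≠ α) (hβ : ∀ c : F, c ^ 3 ≠ β) (hst : t ≠ 0 ∨ s = 0)
    (L N : (F × F) ≃ₗ[ZMod 2] (F × F))
    (h : ∀ p q, pottZhouForm k s α (L p) (L q) = N (pottZhouForm l t β p q)) :
    k = l ∧ (t ≠ 0 → s = t) := by
  have : NeZero m := ⟨by omega⟩
  obtain ⟨a, b, c, d, n, n', ν, hR⟩ := exists_coeffRelations hF (by omega) L N h
  have hne : ∀ γ : F, (∀ c : F, c ^ 3 ≠ γ) → γ ≠ 0 := fun γ hγ h0 => hγ 0 (by simp [h0])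
  have hα' := eq_zero_of_noncube (s := s) hk hα inferInstance
  have hkk := ZMod.natCast_add_natCast_ne_zero (m := m) hk_pos hk_lt hk_lt
  have hll := ZMod.natCast_add_natCast_ne_zero (m := m) hl_pos hl_lt hl_lt
  have hkl : (k : ZMod m) = l ∨ (k : ZMod m) + l = 0 → k = l := by
    rintro (h1 | h1)
    · exact ZMod.eq_of_natCast_eq (by omega) (by omega) h1
    · exact absurd h1 (ZMod.natCast_add_natCast_ne_zero hk_pos hk_lt hl_lt)
  by_cases ht0 : t = 0
  · refine ⟨hkl ?_, fun h0 => absurd ht0 h0⟩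
    obtain rfl : s = 0 := hst.resolve_left (fun h0 => h0 ht0)
    exact hR.eq_or_add_eq_zero_of_shift_eq_zero hα' (fun h0 => hkk (by rw [h0, add_zero]))
  have ht : (t : ZMod m) ≠ 0 := by
    intro h0
    rw [ZMod.natCast_eq_zero_iff] at h0
    have := Nat.le_of_dvd (by omega) h0
    omega
  have htl : (t : ZMod m) ≠ l := by
    intro h0
    have := ZMod.eq_of_natCast_eq (by omega) (by omega) h0
    rw [this] at ht_even
    exact (Nat.not_even_iff_odd.mpr hl) ht_even
  have htl' : (t : ZMod m) + l ≠ 0 := by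
    intro h0
    rw [← Nat.cast_add, ZMod.natCast_eq_zero_iff] at h0
    have := Nat.le_of_dvd (by omega) h0
    omega
  obtain ⟨i, hi⟩ := hR.exists_det_ne_zero
  have hsupp := fun j (hj : j ≠ i) => hR.support_single (hne β hβ) hll ht htl htl' hi hj
  obtain rfl := hkl (hR.eq_or_add_eq_zero hα' hkk hi fun j hj => (hsupp j hj).1)
  refine ⟨rfl, fun _ => ?_⟩
  rcases hR.shift_eq_or_add_eq_zero hα' (hne α hα) (hne β hβ) hkk ht hi hsupp with h1 | h1
  · exact ZMod.eq_of_natCast_eq (by omega) (by omega) h1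
  · rw [← Nat.cast_add, ZMod.natCast_eq_zero_iff] at h1
    have := Nat.le_of_dvd (by omega) h1
    omega

end

theorem theorem1 {F : Type*} [Field F] [Finite F] [Algebra (ZMod 2) F]
    (m : ℕ) (hm : 4 ≤ m) (hm_even : Even m) (hF : Nat.card F = 2 ^ m)
    (k ℓ : ℕ) (hk_pos : 0 < k) (hk_lt : k < m / 2) (hk : Nat.Coprime k m)
    (hℓ_pos : 0 < ℓ) (hℓ_lt : ℓ < m / 2) (hℓ : Nat.Coprime ℓ m)
    (s t : ℕ) (hs_even : Even s) (hs_le : s ≤ m / 2) (ht_even : Even t) (ht_le : t ≤ m / 2)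
    (α β : F) (hα : ∀ c : F, c ^ 3 ≠ α) (hβ : ∀ c : F, c ^ 3 ≠ β) :
    CCZEquivalent (pottZhou k s α) (pottZhou ℓ t β) ↔ k = ℓ ∧ s = t := by
  have hchar : CharP F 2 := charP_of_injective_algebraMap (algebraMap (ZMod 2) F).injective 2
  have hodd : ∀ r : ℕ, Nat.Coprime r m → Odd r := fun r hr =>
    Nat.coprime_two_right.mp (hr.coprime_dvd_right hm_even.two_dvd)
  have : NeZero m := ⟨by omega⟩
  constructor
  · intro h
    have hV : 4 ≤ Module.finrank (ZMod 2) (F × F) := by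
      have h1 := Module.natCard_eq_pow_finrank (K := ZMod 2) (V := F)
      rw [hF, Nat.card_zmod] at h1
      have h2 := Nat.pow_right_injective le_rfl h1
      rw [Module.finrank_prod]
      omega
    obtain ⟨L, N, hLN⟩ := IsQuadraticAPN.exists_linearEquiv_of_ccz hV
      (isQuadraticAPN_pottZhou hF (by omega) hk (hodd k hk) hk_pos hk_lt hs_even hα)
      (isQuadraticAPN_pottZhou hF (by omega) hℓ (hodd ℓ hℓ) hℓ_pos hℓ_lt ht_even hβ) h
    have hLN' : ∀ p q, pottZhouForm k s α (L.symm p) (L.symm q) =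
        N.symm (pottZhouForm ℓ t β p q) := by
      intro p q
      rw [LinearEquiv.eq_symm_apply, ← hLN, L.apply_symm_apply, L.apply_symm_apply]
    by_cases ht : t = 0
    · by_cases hs : s = 0
      · have h1 := eq_of_linearEquiv hm hF hk_pos hk_lt (hodd k hk) hℓ_pos hℓ_lt
          (hodd ℓ hℓ) hs_le ht_even ht_le hα hβ (Or.inr hs) L.symm N.symm hLN'
        exact ⟨h1.1, hs.trans ht.symm⟩
      · have h1 := eq_of_linearEquiv hm hF hℓ_pos hℓ_lt (hodd ℓ hℓ) hk_pos hk_lt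
          (hodd k hk) ht_le hs_even hs_le hβ hα (Or.inl hs) L N hLN
        exact ⟨h1.1.symm, (h1.2 hs).symm⟩
    · have h1 := eq_of_linearEquiv hm hF hk_pos hk_lt (hodd k hk) hℓ_pos hℓ_lt
        (hodd ℓ hℓ) hs_le ht_even ht_le hα hβ (Or.inl ht) L.symm N.symm hLN'
      exact ⟨h1.1, h1.2 ht⟩
  · rintro ⟨rfl, rfl⟩
    obtain ⟨a, ha, e, h⟩ := exists_eq_pow_mul_of_noncube hF hm_even hk hα hβ
    exact ccz_pottZhou_of_eq_pow_mul ha h
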